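/- Let $\mathbb I=[0,1)$. For $n\in\mathbb N$ write $n=\sum_{j\ge0}\varepsilon_j(n)2^j$ with $\varepsilon_j(n)\in\{0,1\}$, $n(k)=\sum_{j=0}^{k}\varepsilon_j(n)2^j$, $l_n=\sum_{k=1}^{n-1}\frac1k$, and, for $n\ge1$, let $|n|$ be the integer with $2^{|n|}\le n<2^{|n|+1}$. For $x\in\mathbb I$ let $x=\sum_{k\ge0}x_k2^{-(k+1)}$, $x_k\in\{0,1\}$, be its binary expansion (the one terminating in zeros if $x$ is a dyadic rational). Let $w_n(x)=(-1)^{\sum_k\varepsilon_k(n)x_k}$ be the Walsh–Paley functions, $\hat f(i)=\int_{\mathbb I}f(t)w_i(t)\,dt$, $S_M(f)=\sum_{i=0}^{M-1}\hat f(i)w_i$, and for $n\ge2$ let $$L_n(f)=\frac1{l_n}\sum_{k=1}^{n-1}\frac{S_k(f)}{n-k},\qquad V_L(n)=\frac1{|n|}\sum_{k=1}^{|n|}\bigl|\varepsilon_k(n)-\varepsilon_{k+1}(n)\bigr|\,l_{n(k-1)}$$ be the Nörlund logarithmic means and the logarithmic variation. Let $X$ be either the space $L_1(\mathbb I)$ of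 integrable real functions with norm $\int_{\mathbb I}|f|$, or the space $C_w(\mathbb I)$ of real functions on $\mathbb I$ that are uniformly continuous with respect to the dyadic distance $\sum_{k\ge0}|x_k-y_k|2^{-(k+1)}$, with norm $\sup_{\mathbb I}|f|$. Theorem. Let $2\le m_0<m_1<m_2<\cdots$ be integers. The condition $\sup_A V_L(m_A)<\infty$ is necessary and sufficient in order that, for every $f\in X$, the sequence $L_{m_A}(f)$ converges to $f$ in the norm of $X$ as $A\to\infty$. It is likewise necessary and sufficient in order that, for every $f\in X$, the sequence $L_{m_A}(f)$ converges in the norm of $X$ to some element of $X$. -/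

import Mathlib

open MeasureTheory Filter Topology

noncomputable section

namespace WalshLog

/-- The unit interval `𝕀 = [0,1)`. -/
def unitIco : Set ℝ := Set.Ico 0 1

/-- The binary digit `ε_k(n)` of the natural number `n`. -/
def bit (n k : ℕ) : ℕ := n / 2 ^ k % 2

/-- `|n|`, the position of the leading binary digit: `2 ^ |n| ≤ n < 2 ^ (|n| + 1)` for `0 < n`. -/
def order (n : ℕ) : ℕ := Nat.log 2 n

/-- The truncation `n(k) = ∑_{j ≤ k} ε_j(n) 2^j`. -/
def trunc (n k : ℕ) : ℕ := ∑ j ∈ Finset.range (k + 1), bit n j * 2 ^ j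

/-- The digit `x_k` in `x = ∑_k x_k 2^{-(k+1)}` for `x ∈ [0,1)`; for dyadic rationals this is the
expansion that terminates in zeros. -/
def digit (x : ℝ) (k : ℕ) : ℕ := ⌊x * 2 ^ (k + 1)⌋₊ % 2

/-- Dyadic addition `x + y = ∑_k |x_k - y_k| 2^{-(k+1)}`. As `+` and `-` agree digitwise, this is
also the dyadic distance between `x` and `y`. -/
def dyadicAdd (x y : ℝ) : ℝ :=
  ∑' k : ℕ, |(digit x k : ℝ) - (digit y k : ℝ)| / 2 ^ (k + 1)

/-- The Rademacher function `ρ_k(x) = (-1)^{x_k}`. -/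
def rademacher (k : ℕ) (x : ℝ) : ℝ := (-1) ^ digit x k

/-- The Walsh–Paley function `w_n = ∏_k ρ_k^{ε_k(n)}`
(all digits of `n` above position `|n|` vanish). -/
def walsh (n : ℕ) (x : ℝ) : ℝ :=
  ∏ k ∈ Finset.range (order n + 1), rademacher k x ^ bit n k

/-- The Walsh–Fourier coefficient `∫_𝕀 f(t) w_i(t) dt`. -/
def coeff (f : ℝ → ℝ) (i : ℕ) : ℝ := ∫ t in unitIco, f t * walsh i t

/-- The partial sum `S_M(f) = ∑_{i < M} f̂(i) w_i`. -/
def partialSum (M : ℕ) (f : ℝ → ℝ) (x : ℝ) : ℝ :=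
  ∑ i ∈ Finset.range M, coeff f i * walsh i x

/-- `l_n = ∑_{k=1}^{n-1} 1/k`. -/
def harm (n : ℕ) : ℝ := ∑ k ∈ Finset.Ico 1 n, 1 / (k : ℝ)

/-- The Nörlund logarithmic mean `L_n(f) = (1/l_n) ∑_{k=1}^{n-1} S_k(f)/(n-k)`. -/
def logMean (n : ℕ) (f : ℝ → ℝ) (x : ℝ) : ℝ :=
  1 / harm n * ∑ k ∈ Finset.Ico 1 n, partialSum k f x / ((n : ℝ) - (k : ℝ))

/-- The logarithmic variation
`V_L(n) = (1/|n|) ∑_{k=1}^{|n|} |ε_k(n) - ε_{k+1}(n)| l_{n(k-1)}`. -/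
def logVariation (n : ℕ) : ℝ :=
  1 / (order n : ℝ) *
    ∑ k ∈ Finset.Icc 1 (order n), |(bit n k : ℝ) - (bit n (k + 1) : ℝ)| * harm (trunc n (k - 1))

/-- The two spaces under consideration: `L₁[0,1)` and `C_w[0,1)`. -/
inductive Space where
  | L1
  | Cw

/-- Membership of (the restriction to `[0,1)` of) a function in the space: integrability on `[0,1)`
for `L₁`, uniform continuity on `[0,1)` for the dyadic distance for `C_w`. -/
def Space.Mem : Space → (ℝ → ℝ) → Prop
  | .L1, f => IntegrableOn f unitIco
  | .Cw, f => ∀ ε > 0, ∃ δ > 0, ∀ x ∈ unitIco, ∀ y ∈ unitIco, dyadicAdd x y < δ → |f x - f y| < ε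

/-- The norm of the space (with value in `[0,∞]` on all functions): the integral of `|f|` over
`[0,1)` for `L₁`, the supremum of `|f|` over `[0,1)` for `C_w`. -/
def Space.xnorm : Space → (ℝ → ℝ) → ENNReal
  | .L1, f => ∫⁻ x in unitIco, ENNReal.ofReal |f x|
  | .Cw, f => ⨆ x ∈ unitIco, ENNReal.ofReal |f x|

/-- The functions `u_A` converge to `g` in the norm of the space. -/
def Space.ConvergesTo (X : Space) (u : ℕ → ℝ → ℝ) (g : ℝ → ℝ) : Prop :=
  Tendsto (fun A => X.xnorm (fun x => u A x - g x)) atTop (𝓝 0)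

end WalshLog

end

/-! `L_n` is integration against the kernel `F_n / l_n`, where `F_n = ∑ D_k/(n-k)` is evaluated at
the dyadic sum of `x` and `t`. The theorem reduces to a two-sided estimate: up to an error `O(l_n)`,
the `L₁` norm of `F_n` is comparable to `|n| V_L(n)`. Since `l_n` and `|n|` are comparable, bounded
`V_L` means exactly bounded normalized kernels.

The estimate rests on a recursion on the leading binary digit (`logKernel_two_pow_add`). Removing
the digit `2^a` from `n = 2^a + m` produces `l_n D_{2^a}`, the sign `e_a` times `F_m`, and a
remainder. By Abel summation and the bound `2n` for Fejér kernels, the remainder has norm at most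
`2(l_n - l_{m+1})`. These bounds telescope, so `F_n` is within `2 l_n` of `w_n ∑ c_k e_k D_{2^k}`,
with `c_k = ε_k(n) l_{n(k)}` (`absInt_logKernel_sub_le`).

The norm of this block sum is comparable to the total variation of `c`. The upper bound is Abel
summation, using that `D_{2^k}` has norm one (`absInt_blockSum_le`). For the lower bound, the block
sum is constant on each set where the first `-1` among the signs occurs at place `j`, and these
constants control the increments of `c` (`sum_meanDev_le_absInt_blockSum`,
`sum_abs_sub_le_meanDev`). Finally `c` has variation `|n| V_L(n) + O(l_n)`, because `l_{n(k)}` is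
monotone in `k` (`abs_coeffVariation_sub_le`).

Sufficiency then follows from uniform boundedness, density of Walsh polynomials, and convergence on
Walsh polynomials (`convergesTo_of_bddAbove`). Necessity follows from the Banach–Steinhaus theorem,
applied to scalar functionals tested on elements of norm at most one that nearly recover the norm of
the kernel (`exists_kernel_bound_of_L1`, `exists_kernel_bound_of_Cw`). -/

namespace WalshLog

/-! ### Pointwise kernel identities for an abstract sequence of signs -/

/-- The Walsh product `∏_k e_k^{ε_k(n)}` attached to a sequence `e`. -/
noncomputable def walshProd (e : ℕ → ℝ) (n : ℕ) : ℝ :=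
  ∏ k ∈ Finset.range (order n + 1), e k ^ bit n k

/-- The Dirichlet kernel `∑_{i < n} w_i`. -/
noncomputable def dirichlet (e : ℕ → ℝ) (n : ℕ) : ℝ := ∑ i ∈ Finset.range n, walshProd e i

/-- The unnormalized Fejér kernel `∑_{k ≤ n} D_k`. -/
noncomputable def fejer (e : ℕ → ℝ) (n : ℕ) : ℝ := ∑ k ∈ Finset.range n, dirichlet e (k + 1)

/-- The unnormalized logarithmic kernel `∑_{k=1}^{n-1} D_k / (n - k)`. -/
noncomputable def logKernel (e : ℕ → ℝ) (n : ℕ) : ℝ :=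
  ∑ k ∈ Finset.Ico 1 n, dirichlet e k / ((n : ℝ) - (k : ℝ))

theorem bit_eq_zero_of_lt {n k : ℕ} (h : n < 2 ^ k) : bit n k = 0 := by
  simp [bit, Nat.div_eq_of_lt h]

theorem bit_le_one (n k : ℕ) : bit n k ≤ 1 := by
  unfold bit; omega

theorem bit_two_pow_add_self {a i : ℕ} (h : i < 2 ^ a) : bit (2 ^ a + i) a = 1 := by
  simp [bit, Nat.add_div_left, Nat.div_eq_of_lt h]

theorem bit_two_pow_add_of_lt {a k : ℕ} (i : ℕ) (h : k < a) : bit (2 ^ a + i) k = bit i k := by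
  obtain ⟨d, rfl⟩ : ∃ d, a = k + d + 1 := ⟨a - k - 1, by omega⟩
  unfold bit
  have : 2 ^ (k + d + 1) + i = i + 2 ^ k * (2 * 2 ^ d) := by ring
  rw [this, Nat.add_mul_div_left _ _ (by positivity)]
  omega

theorem lt_two_pow_order_succ (n : ℕ) : n < 2 ^ (order n + 1) :=
  Nat.lt_pow_succ_log_self (by norm_num) n

theorem walshProd_eq_prod_range (e : ℕ → ℝ) {n N : ℕ} (h : n < 2 ^ N) :
    walshProd e n = ∏ k ∈ Finset.range N, e k ^ bit n k := by
  have key : ∀ M, n < 2 ^ M → ∀ d, ∏ k ∈ Finset.range (M + d), e k ^ bit n k =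
      ∏ k ∈ Finset.range M, e k ^ bit n k := by
    intro M hM d
    induction d with
    | zero => rfl
    | succ d ih =>
      rw [← add_assoc, Finset.prod_range_succ, ih, bit_eq_zero_of_lt, pow_zero, mul_one]
      exact hM.trans_le (Nat.pow_le_pow_right (by norm_num) (by omega))
  unfold walshProd
  rcases le_total N (order n + 1) with hle | hle
  · obtain ⟨d, hd⟩ := Nat.exists_eq_add_of_le hle
    rw [hd, key N h]
  · obtain ⟨d, hd⟩ := Nat.exists_eq_add_of_le hle
    rw [hd, key _ (lt_two_pow_order_succ n)]

theorem walshProd_zero (e : ℕ → ℝ) : walshProd e 0 = 1 := by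
  rw [walshProd_eq_prod_range e (N := 0) (by norm_num)]; simp

theorem walshProd_two_pow_add (e : ℕ → ℝ) {a i : ℕ} (h : i < 2 ^ a) :
    walshProd e (2 ^ a + i) = e a * walshProd e i := by
  rw [walshProd_eq_prod_range e (N := a + 1) (by rw [pow_succ]; omega),
    walshProd_eq_prod_range e h, Finset.prod_range_succ, bit_two_pow_add_self h, pow_one, mul_comm]
  congr 1
  exact Finset.prod_congr rfl fun k hk => by
    rw [bit_two_pow_add_of_lt _ (Finset.mem_range.1 hk)]

theorem dirichlet_two_pow_add (e : ℕ → ℝ) {a m : ℕ} (h : m ≤ 2 ^ a) :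
    dirichlet e (2 ^ a + m) = dirichlet e (2 ^ a) + e a * dirichlet e m := by
  unfold dirichlet
  rw [Finset.sum_range_add, Finset.mul_sum]
  congr 1
  exact Finset.sum_congr rfl fun i hi =>
    walshProd_two_pow_add e ((Finset.mem_range.1 hi).trans_le h)

theorem dirichlet_zero (e : ℕ → ℝ) : dirichlet e 0 = 0 := by simp [dirichlet]

theorem dirichlet_one (e : ℕ → ℝ) : dirichlet e 1 = 1 := by simp [dirichlet, walshProd_zero]

theorem dirichlet_two_pow_succ (e : ℕ → ℝ) (a : ℕ) :
    dirichlet e (2 ^ (a + 1)) = (1 + e a) * dirichlet e (2 ^ a) := by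
  rw [pow_succ, mul_two, dirichlet_two_pow_add e le_rfl]; ring

theorem dirichlet_two_pow (e : ℕ → ℝ) (a : ℕ) :
    dirichlet e (2 ^ a) = ∏ j ∈ Finset.range a, (1 + e j) := by
  induction a with
  | zero => simp [dirichlet_one]
  | succ a ih => rw [dirichlet_two_pow_succ, ih, Finset.prod_range_succ, mul_comm]

section Sign

variable {e : ℕ → ℝ} (he : ∀ k, e k = 1 ∨ e k = -1)

include he

theorem abs_walshProd (n : ℕ) : |walshProd e n| = 1 := by
  unfold walshProd
  rw [Finset.abs_prod]
  refine Finset.prod_eq_one fun k _ => ?_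
  rcases he k with h | h <;> simp [h, abs_pow]

theorem dirichlet_two_pow_nonneg (a : ℕ) : 0 ≤ dirichlet e (2 ^ a) := by
  rw [dirichlet_two_pow]
  refine Finset.prod_nonneg fun k _ => ?_
  rcases he k with h | h <;> norm_num [h]

theorem mul_dirichlet_two_pow {k a : ℕ} (h : k < a) :
    e k * dirichlet e (2 ^ a) = dirichlet e (2 ^ a) := by
  rw [dirichlet_two_pow, ← Finset.mul_prod_erase _ _ (Finset.mem_range.2 h), ← mul_assoc]
  congr 1
  rcases he k with h | h <;> simp [h]

theorem walshProd_mul_dirichlet {a i : ℕ} (h : i < 2 ^ a) :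
    walshProd e i * dirichlet e (2 ^ a) = dirichlet e (2 ^ a) := by
  rw [walshProd_eq_prod_range e h]
  have key : ∀ b ≤ a, (∏ k ∈ Finset.range b, e k ^ bit i k) * dirichlet e (2 ^ a) =
      dirichlet e (2 ^ a) := by
    intro b
    induction b with
    | zero => simp
    | succ b ih =>
      intro hb
      rw [Finset.prod_range_succ, mul_assoc]
      have : e b ^ bit i b * dirichlet e (2 ^ a) = dirichlet e (2 ^ a) := by
        rcases Nat.le_one_iff_eq_zero_or_eq_one.1 (bit_le_one i b) with h0 | h0
        · simp [h0]
        · rw [h0, pow_one, mul_dirichlet_two_pow he (by omega)]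
      rw [this, ih (by omega)]
  exact key a le_rfl

/-- Complementing the first `a` binary digits of `i` multiplies `w_i` by `w_{2^a-1}`, so the last
`i` terms of `D_{2^a}` add up to `w_{2^a-1} D_i`. -/
theorem dirichlet_two_pow_sub {a i : ℕ} (h : i ≤ 2 ^ a) :
    dirichlet e (2 ^ a - i) =
      dirichlet e (2 ^ a) - walshProd e (2 ^ a - 1) * dirichlet e i := by
  induction a generalizing i with
  | zero =>
    have : i = 0 ∨ i = 1 := by simp at h; omega
    rcases this with rfl | rfl <;> simp [dirichlet_zero, dirichlet_one, walshProd_zero]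
  | succ a ih =>
    have hpos : 0 < 2 ^ a := by positivity
    have hW : walshProd e (2 ^ (a + 1) - 1) = e a * walshProd e (2 ^ a - 1) := by
      rw [← walshProd_two_pow_add e (by omega : 2 ^ a - 1 < 2 ^ a)]
      congr 1
      rw [pow_succ]; omega
    have hD : walshProd e (2 ^ a - 1) * dirichlet e (2 ^ a) = dirichlet e (2 ^ a) :=
      walshProd_mul_dirichlet he (by omega)
    rw [hW, dirichlet_two_pow_succ]
    rcases le_total i (2 ^ a) with hi | hi
    · have : 2 ^ (a + 1) - i = 2 ^ a + (2 ^ a - i) := by rw [pow_succ]; omega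
      rw [this, dirichlet_two_pow_add e (by omega), ih hi]
      ring
    · obtain ⟨m, rfl⟩ := Nat.exists_eq_add_of_le hi
      have hm : m ≤ 2 ^ a := by rw [pow_succ] at h; omega
      have : 2 ^ (a + 1) - (2 ^ a + m) = 2 ^ a - m := by rw [pow_succ]; omega
      rw [this, ih hm, dirichlet_two_pow_add e hm]
      have h1 : e a * e a = 1 := by rcases he a with h | h <;> simp [h]
      linear_combination e a * hD + walshProd e (2 ^ a - 1) * dirichlet e m * h1

omit he in
theorem fejer_two_pow_add (e : ℕ → ℝ) {a m : ℕ} (h : m ≤ 2 ^ a) :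
    fejer e (2 ^ a + m) = fejer e (2 ^ a) + m * dirichlet e (2 ^ a) + e a * fejer e m := by
  unfold fejer
  rw [Finset.sum_range_add, add_assoc]
  congr 1
  rw [Finset.mul_sum, ← nsmul_eq_mul, ← Finset.card_range m, ← Finset.sum_const,
    Finset.card_range, ← Finset.sum_add_distrib]
  refine Finset.sum_congr rfl fun k hk => ?_
  rw [add_assoc, dirichlet_two_pow_add e]
  have := Finset.mem_range.1 hk
  omega

/-- Doubling the index gives `(1 + e_a)` times the old kernel plus `2^a D_{2^a}`, and both summands
are nonnegative. -/
theorem fejer_two_pow_nonneg (a : ℕ) : 0 ≤ fejer e (2 ^ a) := by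
  induction a with
  | zero => simp [fejer, dirichlet_one]
  | succ a ih =>
    rw [pow_succ, mul_two, fejer_two_pow_add e le_rfl]
    have h1 : 0 ≤ (1 + e a) * fejer e (2 ^ a) :=
      mul_nonneg (by rcases he a with h | h <;> norm_num [h]) ih
    have h2 := mul_nonneg (Nat.cast_nonneg (α := ℝ) (2 ^ a)) (dirichlet_two_pow_nonneg he a)
    nlinarith

omit he in
theorem harm_reflect (n : ℕ) : ∑ k ∈ Finset.Ico 1 n, 1 / ((n : ℝ) - k) = harm n := by
  unfold harm
  have := Finset.sum_Ico_reflect (fun k => 1 / ((n : ℝ) - k)) 1 (m := n) (n := n) (by omega)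
  simp only [Nat.add_sub_cancel_left, Nat.add_sub_cancel] at this
  rw [← this]
  refine Finset.sum_congr rfl fun k hk => ?_
  rw [Nat.cast_sub (Finset.mem_Ico.1 hk).2.le]
  ring

/-- Subtracting `D_{2^a}` from every `D_k` extracts the first term. What is left is `e_a D_{k-2^a}`
for `k ≥ 2^a`, and `-w_{2^a-1} D_i` for `k = 2^a - i`. -/
theorem logKernel_two_pow_add {a m : ℕ} (h : m < 2 ^ a) :
    logKernel e (2 ^ a + m) = harm (2 ^ a + m) * dirichlet e (2 ^ a) + e a * logKernel e m -
      walshProd e (2 ^ a - 1) * ∑ i ∈ Finset.Ico 1 (2 ^ a), dirichlet e i / ((m : ℝ) + i) := by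
  have hpos : 0 < 2 ^ a := by positivity
  have h0 : logKernel e (2 ^ a + m) = harm (2 ^ a + m) * dirichlet e (2 ^ a) +
      ∑ k ∈ Finset.Ico 1 (2 ^ a + m),
        (dirichlet e k - dirichlet e (2 ^ a)) / (((2 ^ a + m : ℕ) : ℝ) - k) := by
    rw [← harm_reflect, Finset.sum_mul, ← Finset.sum_add_distrib]
    exact Finset.sum_congr rfl fun k _ => by ring
  have h1 : ∑ k ∈ Finset.Ico (2 ^ a) (2 ^ a + m),
      (dirichlet e k - dirichlet e (2 ^ a)) / (((2 ^ a + m : ℕ) : ℝ) - k) =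
      e a * logKernel e m := by
    rw [Finset.sum_Ico_eq_sum_range, Nat.add_sub_cancel_left]
    have : logKernel e m = ∑ k ∈ Finset.range m, dirichlet e k / ((m : ℝ) - k) := by
      unfold logKernel
      rcases Nat.eq_zero_or_pos m with rfl | hm
      · simp
      · rw [Finset.range_eq_Ico, Finset.sum_eq_sum_Ico_succ_bot hm, dirichlet_zero]; simp
    rw [this, Finset.mul_sum]
    refine Finset.sum_congr rfl fun k hk => ?_
    rw [dirichlet_two_pow_add e ((Finset.mem_range.1 hk).trans h).le]
    push_cast
    ring
  have h2 : ∑ k ∈ Finset.Ico 1 (2 ^ a),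
      (dirichlet e k - dirichlet e (2 ^ a)) / (((2 ^ a + m : ℕ) : ℝ) - k) =
      -(walshProd e (2 ^ a - 1) *
        ∑ i ∈ Finset.Ico 1 (2 ^ a), dirichlet e i / ((m : ℝ) + i)) := by
    have := Finset.sum_Ico_reflect (fun k => (dirichlet e k - dirichlet e (2 ^ a)) /
      (((2 ^ a + m : ℕ) : ℝ) - k)) 1 (m := 2 ^ a) (n := 2 ^ a) (by omega)
    simp only [Nat.add_sub_cancel_left, Nat.add_sub_cancel] at this
    rw [← this, Finset.mul_sum, ← Finset.sum_neg_distrib]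
    refine Finset.sum_congr rfl fun k hk => ?_
    have hk := (Finset.mem_Ico.1 hk).2.le
    rw [dirichlet_two_pow_sub he hk, Nat.cast_sub hk]
    push_cast
    ring
  rw [h0, ← Finset.sum_Ico_consecutive _ (show 1 ≤ 2 ^ a from hpos) (Nat.le_add_right _ m), h1, h2]
  ring

omit he in
theorem sum_dirichlet_mul (e : ℕ → ℝ) (b : ℕ → ℝ) (M : ℕ) :
    ∑ i ∈ Finset.range M, dirichlet e (i + 1) * b i =
      ∑ i ∈ Finset.range M, fejer e (i + 1) * (b i - b (i + 1)) + fejer e M * b M := by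
  induction M with
  | zero => simp [fejer]
  | succ M ih =>
    rw [Finset.sum_range_succ, ih, Finset.sum_range_succ]
    have : fejer e (M + 1) = fejer e M + dirichlet e (M + 1) := by
      simp [fejer, Finset.sum_range_succ]
    rw [this]; ring

/-! ### The principal part and its dependence on the coefficients -/

/-- The coefficients `ε_k(n) l_{n(k)}` of the principal part of the logarithmic kernel. -/
noncomputable def mainCoeff (n k : ℕ) : ℝ := bit n k * harm (n % 2 ^ (k + 1))

/-- The principal part of the logarithmic kernel, up to the factor `w_n`. -/
noncomputable def blockSum (e : ℕ → ℝ) (c : ℕ → ℝ) (N : ℕ) : ℝ :=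
  ∑ k ∈ Finset.range N, c k * (e k * dirichlet e (2 ^ k))

omit he in
theorem mainCoeff_two_pow_add_of_lt {a k : ℕ} (i : ℕ) (h : k < a) :
    mainCoeff (2 ^ a + i) k = mainCoeff i k := by
  unfold mainCoeff
  rw [bit_two_pow_add_of_lt i h, Nat.add_mod,
    Nat.mod_eq_zero_of_dvd (pow_dvd_pow 2 (Nat.succ_le_of_lt h))]
  simp

/-- The principal part obeys the recursion of `logKernel_two_pow_add` without its remainder, since
`w_{2^a+m} e_a = w_m` and `w_m D_{2^a} = D_{2^a}`. Hence only the remainders have to be estimated.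
-/
theorem walshProd_mul_blockSum_two_pow_add {a m : ℕ} (h : m < 2 ^ a) :
    walshProd e (2 ^ a + m) * blockSum e (mainCoeff (2 ^ a + m)) (a + 1) =
      harm (2 ^ a + m) * dirichlet e (2 ^ a) +
        e a * (walshProd e m * blockSum e (mainCoeff m) a) := by
  have h1 : blockSum e (mainCoeff (2 ^ a + m)) a = blockSum e (mainCoeff m) a :=
    Finset.sum_congr rfl fun k hk => by
      rw [mainCoeff_two_pow_add_of_lt _ (Finset.mem_range.1 hk)]
  have h2 : mainCoeff (2 ^ a + m) a = harm (2 ^ a + m) := by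
    rw [mainCoeff, bit_two_pow_add_self h, Nat.mod_eq_of_lt (by rw [pow_succ]; omega)]
    simp
  have h3 : blockSum e (mainCoeff (2 ^ a + m)) (a + 1) =
      blockSum e (mainCoeff m) a + harm (2 ^ a + m) * (e a * dirichlet e (2 ^ a)) := by
    rw [← h1, ← h2]; exact Finset.sum_range_succ _ _
  have h4 : e a * e a = 1 := by rcases he a with h | h <;> simp [h]
  rw [h3, walshProd_two_pow_add e h]
  linear_combination (harm (2 ^ a + m) * dirichlet e (2 ^ a) * walshProd e m) * h4 +
    harm (2 ^ a + m) * walshProd_mul_dirichlet he h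

-- Abel summation based on `e_k D_{2^k} = D_{2^{k+1}} - D_{2^k}`.
omit he in
theorem blockSum_eq (e : ℕ → ℝ) (c : ℕ → ℝ) (h0 : c 0 = 0) (N : ℕ) :
    blockSum e c N = c N * dirichlet e (2 ^ N) -
      ∑ k ∈ Finset.range N, (c (k + 1) - c k) * dirichlet e (2 ^ (k + 1)) := by
  induction N with
  | zero => simp [blockSum, h0]
  | succ N ih =>
    have : blockSum e c (N + 1) = blockSum e c N + c N * (e N * dirichlet e (2 ^ N)) :=
      Finset.sum_range_succ _ _
    rw [this, ih, Finset.sum_range_succ, dirichlet_two_pow_succ]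
    ring

/-- The deviation of `c_j` from the weighted mean `∑_{k<j} c_k 2^{k-j}` of its predecessors. -/
noncomputable def meanDev (c : ℕ → ℝ) (j : ℕ) : ℝ :=
  c j - (∑ k ∈ Finset.range j, c k * 2 ^ k) / 2 ^ j

omit he in
theorem sum_abs_sub_le_meanDev (c : ℕ → ℝ) (N : ℕ) :
    ∑ j ∈ Finset.range N, |c (j + 1) - c j| ≤
      2 * ∑ j ∈ Finset.range (N + 1), |meanDev c j| := by
  have h : ∀ j, c (j + 1) - c j = meanDev c (j + 1) - meanDev c j / 2 := by
    intro j
    unfold meanDev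
    rw [Finset.sum_range_succ, pow_succ]
    field_simp
    ring
  have h1 : ∑ j ∈ Finset.range N, |c (j + 1) - c j| ≤
      ∑ j ∈ Finset.range N, (|meanDev c (j + 1)| + |meanDev c j|) := by
    refine Finset.sum_le_sum fun j _ => ?_
    rw [h]
    refine (abs_sub _ _).trans ?_
    rw [abs_div, abs_two]
    linarith [abs_nonneg (meanDev c j)]
  rw [Finset.sum_add_distrib] at h1
  have h2 := Finset.sum_range_succ' (fun j => |meanDev c j|) N
  have h3 := Finset.sum_range_succ (fun j => |meanDev c j|) N
  linarith [abs_nonneg (meanDev c 0), abs_nonneg (meanDev c N)]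

omit he in
/-- On the set where `e_k = 1` for `k < j` and `e_j = -1`, the block sum has the constant value
`-2^j meanDev c j`. -/
theorem blockSum_eq_of_first_neg (c : ℕ → ℝ) {j N : ℕ} (hj : j < N) (h1 : ∀ k < j, e k = 1)
    (h2 : e j = -1) : blockSum e c N = -(2 ^ j * meanDev c j) := by
  have hD : ∀ k ≤ j, dirichlet e (2 ^ k) = 2 ^ k := by
    intro k hk
    rw [dirichlet_two_pow, Finset.prod_congr rfl (g := fun _ => (2 : ℝ))]
    · simp
    · intro i hi
      rw [h1 i ((Finset.mem_range.1 hi).trans_le hk)]; norm_num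
  have hD0 : ∀ k, j < k → dirichlet e (2 ^ k) = 0 := by
    intro k hk
    rw [dirichlet_two_pow]
    exact Finset.prod_eq_zero (Finset.mem_range.2 hk) (by rw [h2]; norm_num)
  obtain ⟨d, rfl⟩ := Nat.exists_eq_add_of_le (Nat.succ_le_of_lt hj)
  unfold blockSum
  rw [Finset.sum_range_add, Finset.sum_range_succ,
    Finset.sum_eq_zero (s := Finset.range d) fun k _ => by rw [hD0 _ (by omega)]; ring,
    hD j le_rfl, h2, Finset.sum_congr rfl fun k hk => by
      rw [h1 k (Finset.mem_range.1 hk), hD k (Finset.mem_range.1 hk).le, one_mul]]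
  unfold meanDev
  field_simp
  ring

/-- Up to normalization, the indicator of the set where `e_k = 1` for `k < j` and `e_j = -1`. -/
noncomputable def firstNeg (e : ℕ → ℝ) (j : ℕ) : ℝ := (1 - e j) * dirichlet e (2 ^ j)

theorem firstNeg_eq (j : ℕ) :
    firstNeg e j = if (∀ k < j, e k = 1) ∧ e j = -1 then 2 ^ (j + 1) else 0 := by
  unfold firstNeg
  rw [dirichlet_two_pow]
  split_ifs with h
  · rw [h.2, Finset.prod_congr rfl (g := fun _ => (2 : ℝ))]
    · simp [pow_succ]; ring
    · intro i hi
      rw [h.1 i (Finset.mem_range.1 hi)]; norm_num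
  · rcases he j with h1 | h1
    · simp [h1]
    · have : ∃ k < j, e k ≠ 1 := by
        by_contra! h2
        exact h ⟨h2, h1⟩
      obtain ⟨k, hk, hk1⟩ := this
      rw [Finset.prod_eq_zero (Finset.mem_range.2 hk)
        (by rw [(he k).resolve_left hk1]; norm_num), mul_zero]

/-- At most one `firstNeg e j` is nonzero, namely the one at the first `-1`. Its value `2^{j+1}` is
twice the factor `2^j` in `blockSum_eq_of_first_neg`. -/
theorem sum_firstNeg_mul_le (c : ℕ → ℝ) (N : ℕ) :
    ∑ j ∈ Finset.range N, firstNeg e j * |meanDev c j| ≤ 2 * |blockSum e c N| := by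
  by_cases h : ∃ j < N, e j = -1
  · classical
    obtain ⟨hjN, hj⟩ := Nat.find_spec h
    set j := Nat.find h
    have hlt : ∀ k < j, e k = 1 := fun k hk =>
      (he k).resolve_right fun hk' => Nat.find_min h hk ⟨hk.trans hjN, hk'⟩
    rw [Finset.sum_eq_single j, blockSum_eq_of_first_neg c hjN hlt hj, abs_neg, abs_mul,
      firstNeg_eq he, if_pos ⟨hlt, hj⟩, abs_of_pos (show (0 : ℝ) < 2 ^ j by positivity), pow_succ]
    · linarith
    · intro k _ hk
      rw [firstNeg_eq he, if_neg, zero_mul]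
      rintro ⟨h1, h2⟩
      rcases lt_or_gt_of_ne hk with hk | hk
      · have := hlt k hk; norm_num [this] at h2
      · have := h1 j hk; norm_num [this] at hj
    · intro hj'
      exact absurd (Finset.mem_range.2 hjN) hj'
  · push Not at h
    rw [Finset.sum_eq_zero]
    · positivity
    · intro j hj
      rw [firstNeg_eq he, if_neg, zero_mul]
      exact fun h' => h j (Finset.mem_range.1 hj) h'.2

end Sign

/-! ### Bounded measurable functions and orthonormality of the Walsh system -/

/-- Bounded measurable functions. -/
def IsBddMeas (h : ℝ → ℝ) : Prop := Measurable h ∧ ∃ C, ∀ t, |h t| ≤ C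

instance isFiniteMeasure_unitIco : IsFiniteMeasure (volume.restrict unitIco) := by
  unfold unitIco; infer_instance

theorem measurableSet_unitIco : MeasurableSet unitIco := measurableSet_Ico

namespace IsBddMeas

variable {f g : ℝ → ℝ}

theorem const (c : ℝ) : IsBddMeas fun _ => c := ⟨measurable_const, |c|, fun _ => le_rfl⟩

theorem add (hf : IsBddMeas f) (hg : IsBddMeas g) : IsBddMeas fun t => f t + g t := by
  obtain ⟨hf, C, hC⟩ := hf
  obtain ⟨hg, D, hD⟩ := hg
  exact ⟨hf.add hg, C + D, fun t => (abs_add_le _ _).trans (add_le_add (hC t) (hD t))⟩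

theorem mul (hf : IsBddMeas f) (hg : IsBddMeas g) : IsBddMeas fun t => f t * g t := by
  obtain ⟨hf, C, hC⟩ := hf
  obtain ⟨hg, D, hD⟩ := hg
  refine ⟨hf.mul hg, C * D, fun t => ?_⟩
  rw [abs_mul]
  exact mul_le_mul (hC t) (hD t) (abs_nonneg _) ((abs_nonneg _).trans (hC t))

theorem sub (hf : IsBddMeas f) (hg : IsBddMeas g) : IsBddMeas fun t => f t - g t := by
  simpa [sub_eq_add_neg] using hf.add ((const (-1)).mul hg)

theorem abs (hf : IsBddMeas f) : IsBddMeas fun t => |f t| := by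
  obtain ⟨hf, C, hC⟩ := hf
  exact ⟨continuous_abs.measurable.comp hf, C, fun t => by rw [abs_abs]; exact hC t⟩

theorem sum {ι : Type*} (s : Finset ι) {F : ι → ℝ → ℝ} (h : ∀ i ∈ s, IsBddMeas (F i)) :
    IsBddMeas fun t => ∑ i ∈ s, F i t := by
  classical
  induction s using Finset.induction_on with
  | empty => simpa using const 0
  | insert a s ha ih =>
    simp only [Finset.sum_insert ha]
    exact (h a (by simp)).add (ih fun i hi => h i (by simp [hi]))

theorem integrable (hf : IsBddMeas f) : IntegrableOn f unitIco := by
  obtain ⟨hf, C, hC⟩ := hf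
  exact Integrable.of_bound hf.aestronglyMeasurable C (ae_of_all _ fun t => hC t)

end IsBddMeas

theorem digit_half_zero {u : ℝ} (hu : u ∈ unitIco) : digit (u / 2) 0 = 0 := by
  have : u / 2 * 2 ^ (0 + 1) = u := by ring
  rw [digit, this, Nat.floor_eq_zero.2 hu.2]

theorem digit_half_succ (u : ℝ) (k : ℕ) : digit (u / 2) (k + 1) = digit u k := by
  have : u / 2 * 2 ^ (k + 1 + 1) = u * 2 ^ (k + 1) := by ring
  rw [digit, this, digit]

theorem digit_half_add_zero {u : ℝ} (hu : u ∈ unitIco) : digit ((u + 1) / 2) 0 = 1 := by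
  have : (u + 1) / 2 * 2 ^ (0 + 1) = u + 1 := by ring
  rw [digit, this, Nat.floor_add_one hu.1, Nat.floor_eq_zero.2 hu.2]

theorem digit_half_add_succ {u : ℝ} (hu : u ∈ unitIco) (k : ℕ) :
    digit ((u + 1) / 2) (k + 1) = digit u k := by
  have : (u + 1) / 2 * 2 ^ (k + 1 + 1) = u * 2 ^ (k + 1) + (2 ^ (k + 1) : ℕ) := by push_cast; ring
  rw [digit, this, Nat.floor_add_natCast (mul_nonneg hu.1 (by positivity)), digit, pow_succ]
  omega

theorem bit_succ (n k : ℕ) : bit n (k + 1) = bit (n / 2) k := by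
  rw [bit, bit, Nat.div_div_eq_div_mul, pow_succ, mul_comm]

theorem walsh_eq_prod_range (x : ℝ) {n N : ℕ} (h : n < 2 ^ N) :
    walsh n x = ∏ k ∈ Finset.range N, rademacher k x ^ bit n k :=
  walshProd_eq_prod_range (fun k => rademacher k x) h

theorem walsh_zero (x : ℝ) : walsh 0 x = 1 := walshProd_zero fun k => rademacher k x

theorem rademacher_eq (k : ℕ) (x : ℝ) : rademacher k x = 1 ∨ rademacher k x = -1 :=
  neg_one_pow_eq_or ℝ _

theorem walsh_half {u : ℝ} (hu : u ∈ unitIco) (n : ℕ) : walsh n (u / 2) = walsh (n / 2) u := by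
  have h1 : n < 2 ^ (n + 1) := n.lt_two_pow_self.trans (Nat.pow_lt_pow_succ (by norm_num))
  have h2 : n / 2 < 2 ^ n := (Nat.div_le_self _ _).trans_lt n.lt_two_pow_self
  rw [walsh_eq_prod_range _ h1, walsh_eq_prod_range _ h2, Finset.prod_range_succ']
  simp only [rademacher, digit_half_zero hu, digit_half_succ, bit_succ, pow_zero, one_pow, mul_one]

theorem walsh_half_add {u : ℝ} (hu : u ∈ unitIco) (n : ℕ) :
    walsh n ((u + 1) / 2) = (-1) ^ n * walsh (n / 2) u := by
  have h1 : n < 2 ^ (n + 1) := n.lt_two_pow_self.trans (Nat.pow_lt_pow_succ (by norm_num))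
  have h2 : n / 2 < 2 ^ n := (Nat.div_le_self _ _).trans_lt n.lt_two_pow_self
  rw [walsh_eq_prod_range _ h1, walsh_eq_prod_range _ h2, Finset.prod_range_succ', mul_comm]
  simp only [rademacher, digit_half_add_zero hu, digit_half_add_succ hu, bit_succ, pow_one]
  rw [bit, pow_zero, Nat.div_one, ← neg_one_pow_eq_pow_mod_two]

theorem measurable_digit (k : ℕ) : Measurable fun x => digit x k :=
  (measurable_from_nat (f := fun n => n % 2)).comp
    (Nat.measurable_floor.comp (measurable_id.mul_const _))

theorem isBddMeas_rademacher (k : ℕ) : IsBddMeas (rademacher k) := by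
  refine ⟨(measurable_from_nat (f := fun n => (-1 : ℝ) ^ n)).comp (measurable_digit k), 1,
    fun t => ?_⟩
  rcases rademacher_eq k t with h | h <;> simp [h]

theorem abs_walsh (n : ℕ) (x : ℝ) : |walsh n x| = 1 :=
  abs_walshProd (fun k => rademacher_eq k x) n

theorem isBddMeas_walsh (n : ℕ) : IsBddMeas (walsh n) := by
  refine ⟨?_, 1, fun t => (abs_walsh n t).le⟩
  exact Finset.measurable_fun_prod _ fun k _ => (isBddMeas_rademacher k).1.pow_const _

theorem setIntegral_unitIco_half {h : ℝ → ℝ} (hh : IsBddMeas h) :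
    ∫ t in unitIco, h t =
      ((∫ t in unitIco, h (t / 2)) + ∫ t in unitIco, h ((t + 1) / 2)) / 2 := by
  have hint : ∀ a b, IntervalIntegrable h volume a b := by
    intro a b
    obtain ⟨hf, C, hC⟩ := hh
    exact (intervalIntegrable_const (c := C)).mono_fun hf.aestronglyMeasurable
      (ae_of_all _ fun t => by simpa using (hC t).trans (le_abs_self C))
  have key : ∀ g : ℝ → ℝ, ∫ t in unitIco, g t = ∫ t in (0 : ℝ)..1, g t := fun g => by
    rw [intervalIntegral.integral_of_le zero_le_one, unitIco, integral_Ico_eq_integral_Ioc]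
  have h2 : ∫ t in (0 : ℝ)..1, h ((t + 1) / 2) = 2 * ∫ t in (1 / 2 : ℝ)..1, h t := by
    have := intervalIntegral.integral_comp_add_right (a := 0) (b := 1) (fun t => h (t / 2)) 1
    rw [this, intervalIntegral.integral_comp_div _ two_ne_zero]
    norm_num
  have h1 : ∫ t in (0 : ℝ)..1, h (t / 2) = 2 * ∫ t in (0 : ℝ)..(1 / 2), h t := by
    rw [intervalIntegral.integral_comp_div _ two_ne_zero]
    norm_num
  rw [key, key, key, h1, h2, ← intervalIntegral.integral_add_adjacent_intervals
    (hint 0 (1 / 2)) (hint (1 / 2) 1)]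
  ring

/-- Induction on the number of binary digits: restricting to the two halves of the interval and
rescaling strips the lowest digit of both indices. -/
theorem integral_walsh_mul_walsh (i j : ℕ) :
    ∫ t in unitIco, walsh i t * walsh j t = if i = j then 1 else 0 := by
  have key : ∀ N, ∀ i < 2 ^ N, ∀ j < 2 ^ N,
      ∫ t in unitIco, walsh i t * walsh j t = if i = j then 1 else 0 := by
    intro N
    induction N with
    | zero =>
      intro i hi j hj
      obtain rfl : i = 0 := by simpa using hi
      obtain rfl : j = 0 := by simpa using hj
      simp [walsh_zero, unitIco]
    | succ N ih =>
      intro i hi j hj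
      rw [pow_succ] at hi hj
      have h1 : ∫ t in unitIco, walsh i (t / 2) * walsh j (t / 2) =
          ∫ t in unitIco, walsh (i / 2) t * walsh (j / 2) t :=
        setIntegral_congr_fun measurableSet_unitIco fun t ht => by
          simp only [walsh_half ht]
      have h2 : ∫ t in unitIco, walsh i ((t + 1) / 2) * walsh j ((t + 1) / 2) =
          (-1) ^ (i + j) * ∫ t in unitIco, walsh (i / 2) t * walsh (j / 2) t := by
        rw [← integral_const_mul]
        exact setIntegral_congr_fun measurableSet_unitIco fun t ht => by
          simp only [walsh_half_add ht]; ring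
      rw [setIntegral_unitIco_half ((isBddMeas_walsh i).mul (isBddMeas_walsh j)), h1, h2,
        ih (i / 2) (by omega) (j / 2) (by omega)]
      -- The two halves differ by the factor `(-1)^{i+j}`: they agree when the stripped digits
      -- coincide and cancel otherwise.
      rcases Nat.even_or_odd (i + j) with h | h
      · rw [h.neg_one_pow]
        have : i / 2 = j / 2 ↔ i = j := by rw [Nat.even_iff] at h; omega
        simp only [this]; ring
      · rw [h.neg_one_pow, if_neg (c := i = j) (by rintro rfl; rw [Nat.odd_iff] at h; omega)]
        ring
  exact key (i + j) i ((Nat.le_add_right i j).trans_lt (i + j).lt_two_pow_self) j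
    ((Nat.le_add_left j i).trans_lt (i + j).lt_two_pow_self)

/-! ### `L₁` norms of the kernels -/

/-- The values `ρ_k(x) ρ_k(t)` of the Rademacher functions at the dyadic sum of `x` and `t`. -/
noncomputable def pairSeq (x t : ℝ) (k : ℕ) : ℝ := rademacher k x * rademacher k t

theorem pairSeq_eq (x t : ℝ) (k : ℕ) : pairSeq x t k = 1 ∨ pairSeq x t k = -1 := by
  unfold pairSeq
  rcases rademacher_eq k x with h | h <;> rcases rademacher_eq k t with h' | h' <;> simp [h, h']

theorem pairSeq_comm (x t : ℝ) : pairSeq x t = pairSeq t x := by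
  funext k; exact mul_comm _ _

theorem walshProd_pairSeq (x t : ℝ) (n : ℕ) :
    walshProd (pairSeq x t) n = walsh n x * walsh n t := by
  simp only [walshProd, walsh, pairSeq, mul_pow, Finset.prod_mul_distrib]

theorem isBddMeas_pairSeq (x : ℝ) (k : ℕ) : IsBddMeas fun t => pairSeq x t k :=
  (IsBddMeas.const _).mul (isBddMeas_rademacher k)

theorem isBddMeas_walshProd (x : ℝ) (n : ℕ) : IsBddMeas fun t => walshProd (pairSeq x t) n := by
  simp only [walshProd_pairSeq]
  exact (IsBddMeas.const _).mul (isBddMeas_walsh n)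

theorem isBddMeas_dirichlet (x : ℝ) (n : ℕ) : IsBddMeas fun t => dirichlet (pairSeq x t) n :=
  IsBddMeas.sum _ fun i _ => isBddMeas_walshProd x i

theorem isBddMeas_fejer (x : ℝ) (n : ℕ) : IsBddMeas fun t => fejer (pairSeq x t) n :=
  IsBddMeas.sum _ fun _ _ => isBddMeas_dirichlet x _

theorem isBddMeas_logKernel (x : ℝ) (n : ℕ) : IsBddMeas fun t => logKernel (pairSeq x t) n := by
  unfold logKernel
  simp only [div_eq_mul_inv]
  exact IsBddMeas.sum _ fun i _ => (isBddMeas_dirichlet x i).mul (IsBddMeas.const _)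

theorem isBddMeas_blockSum (x : ℝ) (c : ℕ → ℝ) (N : ℕ) :
    IsBddMeas fun t => blockSum (pairSeq x t) c N :=
  IsBddMeas.sum _ fun k _ =>
    (IsBddMeas.const _).mul ((isBddMeas_pairSeq x k).mul (isBddMeas_dirichlet x _))

theorem integral_walshProd (x : ℝ) (n : ℕ) :
    ∫ t in unitIco, walshProd (pairSeq x t) n = if n = 0 then 1 else 0 := by
  have h := integral_walsh_mul_walsh n 0
  simp only [walsh_zero, mul_one] at h
  simp only [walshProd_pairSeq]
  rw [integral_const_mul, h]
  split_ifs with h0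
  · simp [h0, walsh_zero]
  · simp

theorem integral_dirichlet (x : ℝ) {n : ℕ} (hn : 0 < n) :
    ∫ t in unitIco, dirichlet (pairSeq x t) n = 1 := by
  unfold dirichlet
  rw [integral_finsetSum _ fun i _ => (isBddMeas_walshProd x i).integrable]
  simp only [integral_walshProd]
  simp [hn.ne']

theorem integral_fejer (x : ℝ) (n : ℕ) : ∫ t in unitIco, fejer (pairSeq x t) n = n := by
  unfold fejer
  rw [integral_finsetSum _ fun i _ => (isBddMeas_dirichlet x _).integrable]
  simp [integral_dirichlet]

/-- The integral of `|h|` over the unit interval. -/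
noncomputable def absInt (h : ℝ → ℝ) : ℝ := ∫ t in unitIco, |h t|

theorem absInt_nonneg (h : ℝ → ℝ) : 0 ≤ absInt h := integral_nonneg fun _ => abs_nonneg _

theorem absInt_add_le {f g : ℝ → ℝ} (hf : IsBddMeas f) (hg : IsBddMeas g) :
    absInt (fun t => f t + g t) ≤ absInt f + absInt g := by
  unfold absInt
  rw [← integral_add hf.abs.integrable hg.abs.integrable]
  exact integral_mono (hf.add hg).abs.integrable (hf.abs.add hg.abs).integrable
    fun t => abs_add_le _ _

theorem absInt_const_mul (c : ℝ) (f : ℝ → ℝ) : absInt (fun t => c * f t) = |c| * absInt f := by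
  unfold absInt
  simp only [abs_mul, integral_const_mul]

theorem absInt_mul_of_abs_eq_one {w f : ℝ → ℝ} (h : ∀ t, |w t| = 1) :
    absInt (fun t => w t * f t) = absInt f := by
  unfold absInt
  simp only [abs_mul, h, one_mul]

theorem absInt_sub_le {f g : ℝ → ℝ} (hf : IsBddMeas f) (hg : IsBddMeas g) :
    absInt (fun t => f t - g t) ≤ absInt f + absInt g := by
  have h := absInt_add_le hf ((IsBddMeas.const (-1)).mul hg)
  rw [absInt_mul_of_abs_eq_one (by simp)] at h
  simpa [sub_eq_add_neg] using h

theorem absInt_sum_le {ι : Type*} (s : Finset ι) {F : ι → ℝ → ℝ}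
    (h : ∀ i ∈ s, IsBddMeas (F i)) :
    absInt (fun t => ∑ i ∈ s, F i t) ≤ ∑ i ∈ s, absInt (F i) := by
  unfold absInt
  rw [← integral_finsetSum _ fun i hi => (h i hi).abs.integrable]
  exact integral_mono (IsBddMeas.sum _ h).abs.integrable
    (IsBddMeas.sum _ fun i hi => (h i hi).abs).integrable fun t => Finset.abs_sum_le_sum_abs _ _

theorem abs_pairSeq (x t : ℝ) (k : ℕ) : |pairSeq x t k| = 1 := by
  rcases pairSeq_eq x t k with h | h <;> simp [h]

theorem absInt_dirichlet_two_pow (x : ℝ) (a : ℕ) :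
    absInt (fun t => dirichlet (pairSeq x t) (2 ^ a)) = 1 := by
  unfold absInt
  simp only [abs_of_nonneg (dirichlet_two_pow_nonneg (pairSeq_eq x _) a)]
  exact integral_dirichlet x (by positivity)

theorem absInt_fejer_two_pow (x : ℝ) (a : ℕ) :
    absInt (fun t => fejer (pairSeq x t) (2 ^ a)) = 2 ^ a := by
  unfold absInt
  simp only [abs_of_nonneg (fejer_two_pow_nonneg (pairSeq_eq x _) a)]
  rw [integral_fejer]; norm_num

theorem exists_eq_two_pow_add {a n : ℕ} (h : n < 2 ^ (a + 1)) (h' : ¬n < 2 ^ a) :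
    ∃ m < 2 ^ a, n = 2 ^ a + m :=
  ⟨n - 2 ^ a, by rw [pow_succ] at h; omega, by omega⟩

theorem absInt_fejer_le (x : ℝ) (n : ℕ) : absInt (fun t => fejer (pairSeq x t) n) ≤ 2 * n := by
  have key : ∀ a, ∀ n < 2 ^ a, absInt (fun t => fejer (pairSeq x t) n) ≤ 2 * n := by
    intro a
    induction a with
    | zero =>
      intro n hn
      obtain rfl : n = 0 := by simpa using hn
      simp [absInt, fejer]
    | succ a ih =>
      intro n hn
      by_cases h : n < 2 ^ a
      · exact ih n h
      · obtain ⟨m, hm, rfl⟩ := exists_eq_two_pow_add hn h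
        simp only [fejer_two_pow_add _ hm.le]
        have h1 := (isBddMeas_dirichlet x (2 ^ a))
        have h2 := absInt_add_le ((isBddMeas_fejer x (2 ^ a)).add ((IsBddMeas.const (m : ℝ)).mul h1))
          ((isBddMeas_pairSeq x a).mul (isBddMeas_fejer x m))
        have h3 := absInt_add_le (isBddMeas_fejer x (2 ^ a)) ((IsBddMeas.const (m : ℝ)).mul h1)
        rw [absInt_const_mul, absInt_dirichlet_two_pow, absInt_fejer_two_pow, Nat.abs_cast] at h3
        rw [absInt_mul_of_abs_eq_one (fun t => abs_pairSeq x t a)] at h2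
        have h4 := ih m hm
        -- The three pieces contribute `2^a + m + 2m`, which is at most `2(2^a + m)` because `m ≤
        -- 2^a`.
        have h5 : (m : ℝ) ≤ 2 ^ a := by exact_mod_cast hm.le
        push_cast
        linarith
  exact key n n n.lt_two_pow_self

theorem harm_mono : Monotone harm := fun m n h =>
  Finset.sum_le_sum_of_subset_of_nonneg (Finset.Ico_subset_Ico_right h) fun _ _ _ => by positivity

theorem harm_nonneg (n : ℕ) : 0 ≤ harm n := Finset.sum_nonneg fun _ _ => by positivity

/-- The weights `1/(m+i)` decrease, so Abel summation writes the sum as a nonnegative combination of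
Fejér kernels. The bound `2i` on their norms then allows the summation to be undone with every `D_i`
replaced by `2`. -/
theorem absInt_sum_dirichlet_div_le (x : ℝ) (a m : ℕ) :
    absInt (fun t => ∑ i ∈ Finset.Ico 1 (2 ^ a), dirichlet (pairSeq x t) i / ((m : ℝ) + i)) ≤
      2 * (harm (2 ^ a + m) - harm (m + 1)) := by
  set M := 2 ^ a - 1 with hM
  have hMa : 2 ^ a = M + 1 := by have : 0 < 2 ^ a := by positivity
                                 omega
  set b : ℕ → ℝ := fun i => 1 / ((m : ℝ) + (i + 1)) with hb
  have hbpos : ∀ i, 0 ≤ b i := fun i => by positivity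
  have hbanti : ∀ i, 0 ≤ b i - b (i + 1) := fun i => by
    rw [sub_nonneg]
    exact one_div_le_one_div_of_le (by positivity) (by push_cast; linarith)
  have h1 : ∀ t, ∑ i ∈ Finset.Ico 1 (2 ^ a), dirichlet (pairSeq x t) i / ((m : ℝ) + i) =
      ∑ i ∈ Finset.range M, fejer (pairSeq x t) (i + 1) * (b i - b (i + 1)) +
        fejer (pairSeq x t) M * b M := by
    intro t
    rw [← sum_dirichlet_mul, Finset.sum_Ico_eq_sum_range]
    refine Finset.sum_congr rfl fun i _ => ?_
    rw [hb, add_comm 1 i]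
    push_cast
    ring
  have h2 : harm (2 ^ a + m) - harm (m + 1) = ∑ i ∈ Finset.range M, b i := by
    unfold harm
    rw [← Finset.sum_Ico_consecutive _ (show 1 ≤ m + 1 by omega) (show m + 1 ≤ 2 ^ a + m by omega),
      add_sub_cancel_left, Finset.sum_Ico_eq_sum_range]
    have : 2 ^ a + m - (m + 1) = M := by omega
    rw [this]
    refine Finset.sum_congr rfl fun i _ => ?_
    rw [hb]
    push_cast
    ring
  -- The reverse Abel summation, in which the norm bounds take the place of the Fejér kernels.
  have h3 : ∀ M, ∑ i ∈ Finset.range M, ((i + 1 : ℕ) : ℝ) * (b i - b (i + 1)) + M * b M =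
      ∑ i ∈ Finset.range M, b i := by
    intro M
    induction M with
    | zero => simp
    | succ M ih =>
      rw [Finset.sum_range_succ, Finset.sum_range_succ, ← ih]
      push_cast
      ring
  have hBM : ∀ i (c : ℝ), IsBddMeas fun t => fejer (pairSeq x t) i * c := fun i c =>
    (isBddMeas_fejer x i).mul (IsBddMeas.const c)
  have h4 : ∀ i (c : ℝ), 0 ≤ c → absInt (fun t => fejer (pairSeq x t) i * c) ≤ 2 * (i * c) := by
    intro i c hc
    have := absInt_const_mul c (fun t => fejer (pairSeq x t) i)
    simp only [mul_comm c] at this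
    rw [this, abs_of_nonneg hc]
    nlinarith [absInt_fejer_le x i]
  simp only [h1]
  rw [h2, ← h3 M, mul_add, Finset.mul_sum]
  refine (absInt_add_le (IsBddMeas.sum _ fun i _ => hBM _ _) (hBM _ _)).trans
    (add_le_add ((absInt_sum_le _ fun i _ => hBM _ _).trans (Finset.sum_le_sum fun i _ => ?_)) ?_)
  · exact h4 _ _ (hbanti i)
  · exact h4 _ _ (hbpos M)

theorem isBddMeas_walshProd_mul_blockSum (x : ℝ) (n : ℕ) (c : ℕ → ℝ) (N : ℕ) :
    IsBddMeas fun t => walshProd (pairSeq x t) n * blockSum (pairSeq x t) c N :=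
  (isBddMeas_walshProd x n).mul (isBddMeas_blockSum x c N)

theorem mainCoeff_eq_zero {n k : ℕ} (h : n < 2 ^ k) : mainCoeff n k = 0 := by
  simp [mainCoeff, bit_eq_zero_of_lt h]

theorem blockSum_succ_of_lt (e : ℕ → ℝ) {n N : ℕ} (h : n < 2 ^ N) :
    blockSum e (mainCoeff n) (N + 1) = blockSum e (mainCoeff n) N := by
  unfold blockSum
  rw [Finset.sum_range_succ, mainCoeff_eq_zero h]
  ring

/-- Each leading digit costs `2(l_n - l_{m+1})`, while the induction hypothesis contributes `2 l_m ≤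
2 l_{m+1}`; the costs telescope. -/
theorem absInt_logKernel_sub_le (x : ℝ) {n N : ℕ} (hn : n < 2 ^ N) :
    absInt (fun t => logKernel (pairSeq x t) n -
      walshProd (pairSeq x t) n * blockSum (pairSeq x t) (mainCoeff n) N) ≤ 2 * harm n := by
  induction N generalizing n with
  | zero =>
    obtain rfl : n = 0 := by simpa using hn
    simp [absInt, logKernel, blockSum, harm]
  | succ a ih =>
    by_cases h : n < 2 ^ a
    · simp only [blockSum_succ_of_lt _ h]
      exact ih h
    · obtain ⟨m, hm, rfl⟩ := exists_eq_two_pow_add hn h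
      have h1 : ∀ t, logKernel (pairSeq x t) (2 ^ a + m) - walshProd (pairSeq x t) (2 ^ a + m) *
          blockSum (pairSeq x t) (mainCoeff (2 ^ a + m)) (a + 1) =
          pairSeq x t a * (logKernel (pairSeq x t) m -
            walshProd (pairSeq x t) m * blockSum (pairSeq x t) (mainCoeff m) a) -
          walshProd (pairSeq x t) (2 ^ a - 1) *
            ∑ i ∈ Finset.Ico 1 (2 ^ a), dirichlet (pairSeq x t) i / ((m : ℝ) + i) := by
        intro t
        rw [logKernel_two_pow_add (pairSeq_eq x t) hm,
          walshProd_mul_blockSum_two_pow_add (pairSeq_eq x t) hm]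
        ring
      have hT : IsBddMeas fun t =>
          ∑ i ∈ Finset.Ico 1 (2 ^ a), dirichlet (pairSeq x t) i / ((m : ℝ) + i) := by
        simp only [div_eq_mul_inv]
        exact IsBddMeas.sum _ fun i _ => (isBddMeas_dirichlet x i).mul (IsBddMeas.const _)
      simp only [h1]
      have h2 := absInt_sub_le ((isBddMeas_pairSeq x a).mul ((isBddMeas_logKernel x m).sub
        (isBddMeas_walshProd_mul_blockSum x m (mainCoeff m) a)))
        ((isBddMeas_walshProd x (2 ^ a - 1)).mul hT)
      rw [absInt_mul_of_abs_eq_one (fun t => abs_pairSeq x t a),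
        absInt_mul_of_abs_eq_one (fun t => abs_walshProd (pairSeq_eq x t) _)] at h2
      have h3 := ih hm
      have h4 := absInt_sum_dirichlet_div_le x a m
      have h5 := harm_mono (Nat.le_succ m)
      rw [Nat.succ_eq_add_one] at h5
      linarith

theorem absInt_blockSum_le (x : ℝ) (c : ℕ → ℝ) (h0 : c 0 = 0) (N : ℕ) (hN : c N = 0) :
    absInt (fun t => blockSum (pairSeq x t) c N) ≤
      ∑ k ∈ Finset.range N, |c (k + 1) - c k| := by
  have h : ∀ t, blockSum (pairSeq x t) c N = -1 *
      ∑ k ∈ Finset.range N, (c (k + 1) - c k) * dirichlet (pairSeq x t) (2 ^ (k + 1)) := by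
    intro t; rw [blockSum_eq _ c h0, hN]; ring
  simp only [h]
  rw [absInt_mul_of_abs_eq_one (by simp)]
  refine (absInt_sum_le _ fun k _ =>
    (IsBddMeas.const _).mul (isBddMeas_dirichlet x _)).trans_eq ?_
  refine Finset.sum_congr rfl fun k _ => ?_
  rw [absInt_const_mul, absInt_dirichlet_two_pow, mul_one]

theorem isBddMeas_firstNeg (x : ℝ) (j : ℕ) : IsBddMeas fun t => firstNeg (pairSeq x t) j :=
  ((IsBddMeas.const 1).sub (isBddMeas_pairSeq x j)).mul (isBddMeas_dirichlet x _)

theorem integral_firstNeg (x : ℝ) (j : ℕ) : ∫ t in unitIco, firstNeg (pairSeq x t) j = 1 := by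
  have h : ∀ t, firstNeg (pairSeq x t) j =
      2 * dirichlet (pairSeq x t) (2 ^ j) - dirichlet (pairSeq x t) (2 ^ (j + 1)) := by
    intro t; rw [firstNeg, dirichlet_two_pow_succ]; ring
  simp only [h]
  rw [integral_sub ((isBddMeas_dirichlet x _).integrable.const_mul 2)
    (isBddMeas_dirichlet x _).integrable, integral_const_mul,
    integral_dirichlet x (by positivity), integral_dirichlet x (by positivity)]
  norm_num

/-- Integrates `sum_firstNeg_mul_le`; `firstNeg` is normalized to have integral one. -/
theorem sum_meanDev_le_absInt_blockSum (x : ℝ) (c : ℕ → ℝ) (N : ℕ) :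
    ∑ j ∈ Finset.range N, |meanDev c j| ≤ 2 * absInt (fun t => blockSum (pairSeq x t) c N) := by
  have hB : ∀ j, IsBddMeas fun t => firstNeg (pairSeq x t) j * |meanDev c j| := fun j =>
    (isBddMeas_firstNeg x j).mul (IsBddMeas.const _)
  have h := integral_mono (IsBddMeas.sum (Finset.range N) fun j _ => hB j).integrable
    ((IsBddMeas.const 2).mul (isBddMeas_blockSum x c N).abs).integrable
    (fun t => sum_firstNeg_mul_le (pairSeq_eq x t) c N)
  rw [integral_finsetSum _ fun j _ => (hB j).integrable, integral_const_mul] at h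
  simpa only [integral_mul_const, integral_firstNeg, one_mul, absInt] using h

/-! ### Comparison of the kernel norm with the logarithmic variation -/

/-- The total variation of the coefficients of the principal part. -/
noncomputable def coeffVariation (n : ℕ) : ℝ :=
  ∑ k ∈ Finset.range (order n + 1), |mainCoeff n (k + 1) - mainCoeff n k|

theorem mainCoeff_zero (n : ℕ) : mainCoeff n 0 = 0 := by
  -- The coefficient is at most `l_1`, and `l_0 = l_1 = 0` as empty sums.
  have : n % 2 ^ (0 + 1) = 0 ∨ n % 2 ^ (0 + 1) = 1 := by omega
  rcases this with h | h <;> simp only [mainCoeff, h] <;> simp [harm]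

theorem absInt_logKernel_le (x : ℝ) (n : ℕ) :
    absInt (fun t => logKernel (pairSeq x t) n) ≤ 2 * harm n + coeffVariation n := by
  have hn := lt_two_pow_order_succ n
  have h1 := absInt_logKernel_sub_le x hn
  have h2 := absInt_blockSum_le x (mainCoeff n) (mainCoeff_zero n) _ (mainCoeff_eq_zero hn)
  have h3 := absInt_add_le ((isBddMeas_logKernel x n).sub
    (isBddMeas_walshProd_mul_blockSum x n (mainCoeff n) (order n + 1)))
    (isBddMeas_walshProd_mul_blockSum x n (mainCoeff n) (order n + 1))
  rw [absInt_mul_of_abs_eq_one (fun t => abs_walshProd (pairSeq_eq x t) _)] at h3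
  simp only [sub_add_cancel] at h3
  unfold coeffVariation
  linarith

theorem coeffVariation_le (x : ℝ) (n : ℕ) :
    coeffVariation n ≤ 4 * (absInt (fun t => logKernel (pairSeq x t) n) + 2 * harm n) := by
  have hn := lt_two_pow_order_succ n
  have h1 := absInt_logKernel_sub_le x hn
  -- One extra block with zero coefficient is included, because the increments up to `order n + 1`
  -- involve one more deviation than there are increments.
  have h2 := sum_meanDev_le_absInt_blockSum x (mainCoeff n) (order n + 1 + 1)
  simp only [blockSum_succ_of_lt _ hn] at h2
  have h3 := absInt_sub_le (isBddMeas_logKernel x n) ((isBddMeas_logKernel x n).sub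
    (isBddMeas_walshProd_mul_blockSum x n (mainCoeff n) (order n + 1)))
  simp only [sub_sub_cancel] at h3
  rw [absInt_mul_of_abs_eq_one (fun t => abs_walshProd (pairSeq_eq x t) _)] at h3
  have h4 := sum_abs_sub_le_meanDev (mainCoeff n) (order n + 1)
  unfold coeffVariation
  linarith

theorem trunc_eq_mod (n k : ℕ) : trunc n k = n % 2 ^ (k + 1) := by
  unfold trunc
  have key : ∀ N, ∑ j ∈ Finset.range N, bit n j * 2 ^ j = n % 2 ^ N := by
    intro N
    induction N with
    | zero => simp [Nat.mod_one]
    | succ N ih => rw [Finset.sum_range_succ, ih, pow_succ, Nat.mod_mul, bit, mul_comm (2 ^ N)]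
  exact key _

theorem harm_mod_mono (n : ℕ) : Monotone fun k => harm (n % 2 ^ k) :=
  monotone_nat_of_le_succ fun k => harm_mono (by
    rw [pow_succ, Nat.mod_mul]; exact Nat.le_add_right _ _)

/-- In each increment of `c` both logarithmic factors are replaced by the smaller `μ (k + 1)`. The
cost consists of increments of the monotone `μ`, which telescope to at most `3 l_n`; the initial
term `|c_1|` costs one more `l_n`. -/
theorem abs_coeffVariation_sub_le {n : ℕ} (hn : 2 ≤ n) :
    |coeffVariation n - order n * logVariation n| ≤ 4 * harm n := by
  set a := order n with ha
  have ha1 : 1 ≤ a := Nat.le_log_of_pow_le (by norm_num) (by simpa using hn)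
  set μ : ℕ → ℝ := fun k => harm (n % 2 ^ k) with hμ
  have hμ_mono : Monotone μ := harm_mod_mono n
  have hμ_nonneg : ∀ k, 0 ≤ μ k := fun k => harm_nonneg _
  have hμ_le : ∀ k, μ k ≤ harm n := fun k => harm_mono (Nat.mod_le _ _)
  have hbit : ∀ k, 0 ≤ (bit n k : ℝ) ∧ (bit n k : ℝ) ≤ 1 := fun k =>
    ⟨Nat.cast_nonneg _, by exact_mod_cast bit_le_one n k⟩
  have hc : ∀ k, mainCoeff n k = bit n k * μ (k + 1) := fun k => rfl
  have hV : a * logVariation n =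
      ∑ k ∈ Finset.range a, |(bit n (k + 2) : ℝ) - bit n (k + 1)| * μ (k + 1) := by
    have : (a : ℝ) ≠ 0 := by positivity
    unfold logVariation
    rw [← ha, ← mul_assoc, mul_one_div_cancel this, one_mul, ← Finset.Ico_add_one_right_eq_Icc,
      Finset.sum_Ico_eq_sum_range, Nat.add_sub_cancel]
    refine Finset.sum_congr rfl fun k _ => ?_
    rw [trunc_eq_mod, abs_sub_comm, add_comm 1 k, Nat.add_sub_cancel]
  have hC : coeffVariation n = ∑ k ∈ Finset.range a, |mainCoeff n (k + 2) - mainCoeff n (k + 1)| +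
      |mainCoeff n 1| := by
    unfold coeffVariation
    rw [← ha, Finset.sum_range_succ', mainCoeff_zero, sub_zero]
  have h1 : |mainCoeff n 1| ≤ harm n := by
    rw [hc, abs_of_nonneg (mul_nonneg (hbit _).1 (hμ_nonneg _))]
    have := mul_le_mul (hbit 1).2 (hμ_le 2) (hμ_nonneg _) zero_le_one
    linarith
  have h2 : |∑ k ∈ Finset.range a, |mainCoeff n (k + 2) - mainCoeff n (k + 1)| -
      ∑ k ∈ Finset.range a, |(bit n (k + 2) : ℝ) - bit n (k + 1)| * μ (k + 1)| ≤
      ∑ k ∈ Finset.range a, ((μ (k + 1 + 2) - μ (k + 2)) + 2 * (μ (k + 1 + 1) - μ (k + 1))) := by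
    rw [← Finset.sum_sub_distrib]
    refine (Finset.abs_sum_le_sum_abs _ _).trans (Finset.sum_le_sum fun k _ => ?_)
    rw [← abs_of_nonneg (hμ_nonneg (k + 1)), ← abs_mul, abs_of_nonneg (hμ_nonneg (k + 1))]
    refine (abs_abs_sub_abs_le _ _).trans ?_
    have e1 : mainCoeff n (k + 2) - mainCoeff n (k + 1) -
        ((bit n (k + 2) : ℝ) - bit n (k + 1)) * μ (k + 1) =
        bit n (k + 2) * (μ (k + 3) - μ (k + 1)) - bit n (k + 1) * (μ (k + 2) - μ (k + 1)) := by
      rw [hc, hc]; ring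
    rw [e1]
    have m1 : 0 ≤ μ (k + 3) - μ (k + 1) := sub_nonneg.2 (hμ_mono (by omega))
    have m2 : 0 ≤ μ (k + 2) - μ (k + 1) := sub_nonneg.2 (hμ_mono (by omega))
    have b1 := mul_le_of_le_one_left m1 (hbit (k + 2)).2
    have b2 := mul_le_of_le_one_left m2 (hbit (k + 1)).2
    have b3 := mul_nonneg (hbit (k + 2)).1 m1
    have b4 := mul_nonneg (hbit (k + 1)).1 m2
    rw [abs_le]
    simp only [show k + 1 + 2 = k + 3 from rfl, show k + 1 + 1 = k + 2 from rfl]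
    constructor <;> linarith
  rw [Finset.sum_add_distrib, ← Finset.mul_sum, Finset.sum_range_sub (fun k => μ (k + 1)) a,
    Finset.sum_range_sub (fun k => μ (k + 2)) a] at h2
  rw [hC, hV]
  have m1 := hμ_le (a + 2)
  have m2 := hμ_le (a + 1)
  have m3 := hμ_nonneg (0 + 2)
  have m4 := hμ_nonneg (0 + 1)
  have m5 := abs_nonneg (mainCoeff n 1)
  rw [abs_le] at h2 ⊢
  constructor <;> linarith [h2.1, h2.2]

theorem harm_two_pow_succ (a : ℕ) :
    harm (2 ^ (a + 1)) = harm (2 ^ a) + ∑ k ∈ (Finset.Ico (2 ^ a) (2 ^ (a + 1)) : Finset ℕ), 1 / (k : ℝ) :=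
  (Finset.sum_Ico_consecutive _ Nat.one_le_two_pow
    (Nat.pow_le_pow_right (by norm_num) (Nat.le_succ a))).symm

theorem card_Ico_two_pow (a : ℕ) : (Finset.Ico (2 ^ a) (2 ^ (a + 1))).card = 2 ^ a := by
  rw [Nat.card_Ico, pow_succ]; omega

theorem half_le_harm_two_pow (a : ℕ) : (a : ℝ) / 2 ≤ harm (2 ^ a) := by
  induction a with
  | zero => simp [harm]
  | succ a ih =>
    have := Finset.card_nsmul_le_sum (Finset.Ico (2 ^ a) (2 ^ (a + 1)))
      (fun k : ℕ => 1 / (k : ℝ)) (1 / 2 ^ (a + 1)) fun k hk => by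
        have hk := Finset.mem_Ico.1 hk
        refine one_div_le_one_div_of_le ?_ (by exact_mod_cast hk.2.le)
        exact_mod_cast (by positivity : 0 < 2 ^ a).trans_le hk.1
    rw [card_Ico_two_pow, nsmul_eq_mul, pow_succ] at this
    rw [harm_two_pow_succ]
    have e : ((2 ^ a : ℕ) : ℝ) * (1 / (2 ^ a * 2)) = 1 / 2 := by push_cast; field_simp
    rw [e] at this
    push_cast
    linarith

theorem harm_two_pow_le (a : ℕ) : harm (2 ^ a) ≤ a := by
  induction a with
  | zero => simp [harm]
  | succ a ih =>
    have := Finset.sum_le_card_nsmul (Finset.Ico (2 ^ a) (2 ^ (a + 1)))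
      (fun k : ℕ => 1 / (k : ℝ)) (1 / 2 ^ a) fun k hk => by
        have hk := Finset.mem_Ico.1 hk
        exact one_div_le_one_div_of_le (by positivity) (by exact_mod_cast hk.1)
    rw [card_Ico_two_pow, nsmul_eq_mul] at this
    have e : ((2 ^ a : ℕ) : ℝ) * (1 / 2 ^ a) = 1 := by push_cast; field_simp
    rw [e] at this
    rw [harm_two_pow_succ]
    push_cast
    linarith

theorem order_le_harm {n : ℕ} (hn : 2 ≤ n) : (order n : ℝ) ≤ 2 * harm n := by
  have h := half_le_harm_two_pow (order n)
  have := harm_mono (Nat.pow_log_le_self 2 (by omega : n ≠ 0))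
  unfold order at *
  linarith

theorem harm_le_order {n : ℕ} (hn : 2 ≤ n) : harm n ≤ 2 * order n := by
  have h := harm_two_pow_le (order n + 1)
  have := harm_mono (lt_two_pow_order_succ n).le
  have h1 : 1 ≤ order n := Nat.le_log_of_pow_le (by norm_num) (by simpa using hn)
  have h1 : (1 : ℝ) ≤ order n := by exact_mod_cast h1
  push_cast at h
  linarith

theorem one_le_harm {n : ℕ} (hn : 2 ≤ n) : 1 ≤ harm n :=
  le_trans (by simp [harm]) (harm_mono hn)

theorem logVariation_nonneg (n : ℕ) : 0 ≤ logVariation n :=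
  mul_nonneg (by positivity)
    (Finset.sum_nonneg fun _ _ => mul_nonneg (abs_nonneg _) (harm_nonneg _))

theorem absInt_logKernel_le_logVariation (x : ℝ) {n : ℕ} (hn : 2 ≤ n) :
    absInt (fun t => logKernel (pairSeq x t) n) ≤ (6 + 2 * logVariation n) * harm n := by
  have h1 := absInt_logKernel_le x n
  have h2 := (abs_le.1 (abs_coeffVariation_sub_le hn)).2
  have h3 := mul_le_mul_of_nonneg_right (order_le_harm hn) (logVariation_nonneg n)
  linarith

/-- The constant arises from `|n| V_L ≤ 4(C + 2) l_n + 4 l_n` followed by `l_n ≤ 2|n|`. A kernel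
bound at a single `x` is enough. -/
theorem logVariation_le (x : ℝ) {n : ℕ} (hn : 2 ≤ n) {C : ℝ} (hC : 0 ≤ C)
    (h : absInt (fun t => logKernel (pairSeq x t) n) ≤ C * harm n) :
    logVariation n ≤ 2 * (12 + 4 * C) := by
  have h1 := coeffVariation_le x n
  have h2 := (abs_le.1 (abs_coeffVariation_sub_le hn)).1
  have h3 := harm_le_order hn
  have h4 : (0 : ℝ) < order n := by linarith [one_le_harm hn]
  have h5 : order n * logVariation n ≤ order n * (2 * (12 + 4 * C)) := by
    have := mul_le_mul_of_nonneg_right h3 (by linarith : 0 ≤ 12 + 4 * C)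
    linarith
  exact le_of_mul_le_mul_left h5 h4

/-! ### Integral representation and operator norm of the means -/

theorem IsBddMeas.integrable_mul {f h : ℝ → ℝ} (hf : IntegrableOn f unitIco) (hh : IsBddMeas h) :
    IntegrableOn (fun t => f t * h t) unitIco := by
  obtain ⟨hm, C, hC⟩ := hh
  exact Integrable.mul_bdd hf hm.aestronglyMeasurable (ae_of_all _ hC)

theorem coeff_mul_walsh (f : ℝ → ℝ) (i : ℕ) (x : ℝ) :
    coeff f i * walsh i x = ∫ t in unitIco, f t * walshProd (pairSeq x t) i := by
  unfold coeff
  rw [← integral_mul_const]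
  simp only [walshProd_pairSeq]
  exact integral_congr_ae (ae_of_all _ fun t => by ring)

theorem partialSum_eq_integral {f : ℝ → ℝ} (hf : IntegrableOn f unitIco) (M : ℕ) (x : ℝ) :
    partialSum M f x = ∫ t in unitIco, f t * dirichlet (pairSeq x t) M := by
  unfold partialSum dirichlet
  simp only [coeff_mul_walsh, Finset.mul_sum]
  exact (integral_finsetSum _ fun i _ => (isBddMeas_walshProd x i).integrable_mul hf).symm

theorem logMean_eq_integral {f : ℝ → ℝ} (hf : IntegrableOn f unitIco) (n : ℕ) (x : ℝ) :
    logMean n f x = 1 / harm n * ∫ t in unitIco, f t * logKernel (pairSeq x t) n := by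
  unfold logMean logKernel
  simp only [partialSum_eq_integral hf, Finset.mul_sum]
  rw [integral_finsetSum (Finset.Ico 1 n)]
  · rw [Finset.mul_sum]
    refine Finset.sum_congr rfl fun k _ => ?_
    rw [← integral_div]
    congr 1
    exact integral_congr_ae (ae_of_all _ fun t => by ring)
  · intro k _
    simp only [div_eq_mul_inv]
    exact ((isBddMeas_dirichlet x k).mul (IsBddMeas.const ((n : ℝ) - k)⁻¹)).integrable_mul hf

theorem isBddMeas_partialSum (M : ℕ) (f : ℝ → ℝ) : IsBddMeas (partialSum M f) :=
  IsBddMeas.sum _ fun i _ => (IsBddMeas.const _).mul (isBddMeas_walsh i)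

theorem isBddMeas_logMean (n : ℕ) (f : ℝ → ℝ) : IsBddMeas (logMean n f) := by
  unfold logMean
  simp only [div_eq_mul_inv]
  exact (IsBddMeas.const _).mul
    (IsBddMeas.sum _ fun k _ => (isBddMeas_partialSum k f).mul (IsBddMeas.const _))

theorem logMean_sub {f g : ℝ → ℝ} (hf : IntegrableOn f unitIco) (hg : IntegrableOn g unitIco)
    (n : ℕ) (x : ℝ) : logMean n (fun t => f t - g t) x = logMean n f x - logMean n g x := by
  have hfg : IntegrableOn (fun t => f t - g t) unitIco := hf.sub hg
  rw [logMean_eq_integral hf, logMean_eq_integral hg, logMean_eq_integral hfg, ← mul_sub,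
    ← integral_sub ((isBddMeas_logKernel x n).integrable_mul hf)
      ((isBddMeas_logKernel x n).integrable_mul hg)]
  simp only [sub_mul]

namespace Space

theorem xnorm_add_le (X : Space) {f g : ℝ → ℝ} (hf : AEMeasurable f (volume.restrict unitIco)) :
    X.xnorm (fun x => f x + g x) ≤ X.xnorm f + X.xnorm g := by
  have h : ∀ x, ENNReal.ofReal |f x + g x| ≤ ENNReal.ofReal |f x| + ENNReal.ofReal |g x| :=
    fun x => by
      rw [← ENNReal.ofReal_add (abs_nonneg _) (abs_nonneg _)]
      exact ENNReal.ofReal_le_ofReal (abs_add_le _ _)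
  cases X with
  | L1 =>
    have hf' : AEMeasurable (fun x => ENNReal.ofReal |f x|) (volume.restrict unitIco) :=
      (continuous_abs.measurable.comp_aemeasurable hf).ennreal_ofReal
    exact (lintegral_mono h).trans_eq (lintegral_add_left' hf' _)
  | Cw =>
    exact iSup₂_le fun x hx => (h x).trans (add_le_add
      (le_iSup₂ (f := fun x (_ : x ∈ unitIco) => ENNReal.ofReal |f x|) x hx)
      (le_iSup₂ (f := fun x (_ : x ∈ unitIco) => ENNReal.ofReal |g x|) x hx))

theorem xnorm_le_ofReal (X : Space) {f : ℝ → ℝ} {C : ℝ} (h : ∀ x ∈ unitIco, |f x| ≤ C) :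
    X.xnorm f ≤ ENNReal.ofReal C := by
  cases X with
  | L1 =>
    refine (setLIntegral_mono' measurableSet_unitIco
      fun x hx => ENNReal.ofReal_le_ofReal (h x hx)).trans ?_
    simp [unitIco]
  | Cw => exact iSup₂_le fun x hx => ENNReal.ofReal_le_ofReal (h x hx)

theorem xnorm_congr (X : Space) {f g : ℝ → ℝ} (h : ∀ x ∈ unitIco, |f x| = |g x|) :
    X.xnorm f = X.xnorm g := by
  cases X with
  | L1 => exact setLIntegral_congr_fun measurableSet_unitIco fun x hx => by simp only [h x hx]
  | Cw => exact iSup_congr fun x => iSup_congr fun hx => by rw [h x hx]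

end Space

theorem ofReal_abs_logMean_le {f : ℝ → ℝ} (hf : IntegrableOn f unitIco) (n : ℕ) (x : ℝ) :
    ENNReal.ofReal |logMean n f x| ≤ ∫⁻ t in unitIco,
      ENNReal.ofReal |f t| * ENNReal.ofReal |logKernel (pairSeq x t) n / harm n| := by
  have : logMean n f x = ∫ t in unitIco, f t * (logKernel (pairSeq x t) n / harm n) := by
    rw [logMean_eq_integral hf, ← integral_const_mul]
    exact integral_congr_ae (ae_of_all _ fun t => by ring)
  rw [this, ← Real.enorm_eq_ofReal_abs]
  refine (enorm_integral_le_lintegral_enorm _).trans_eq ?_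
  simp only [enorm_mul, Real.enorm_eq_ofReal_abs]

theorem lintegral_logKernel_le {n : ℕ} (hn : 2 ≤ n) {C : ℝ}
    (x : ℝ) (hC : absInt (fun t => logKernel (pairSeq x t) n) ≤ C * harm n) :
    ∫⁻ t in unitIco, ENNReal.ofReal |logKernel (pairSeq x t) n / harm n| ≤ ENNReal.ofReal C := by
  have hl : 0 < harm n := zero_lt_one.trans_le (one_le_harm hn)
  have hB : IsBddMeas fun t => logKernel (pairSeq x t) n / harm n := by
    simp only [div_eq_mul_inv]
    exact (isBddMeas_logKernel x n).mul (IsBddMeas.const _)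
  rw [← ofReal_integral_eq_lintegral_ofReal hB.abs.integrable (ae_of_all _ fun t => abs_nonneg _)]
  refine ENNReal.ofReal_le_ofReal ?_
  simp only [abs_div, abs_of_pos hl, integral_div]
  exact (div_le_iff₀ hl).2 hC

theorem measurable_logKernel_uncurry (n : ℕ) :
    Measurable fun p : ℝ × ℝ => logKernel (pairSeq p.1 p.2) n := by
  unfold logKernel dirichlet
  simp only [walshProd_pairSeq]
  refine Finset.measurable_fun_sum _ fun k _ => Measurable.div_const ?_ _
  exact Finset.measurable_fun_sum _ fun i _ =>
    ((isBddMeas_walsh i).1.comp measurable_fst).mul ((isBddMeas_walsh i).1.comp measurable_snd)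

/-- The norm of `L_n` is controlled by the `L₁` norm of its kernel. -/
theorem xnorm_logMean_le (X : Space) {n : ℕ} (hn : 2 ≤ n) {C : ℝ}
    (hC : ∀ x, absInt (fun t => logKernel (pairSeq x t) n) ≤ C * harm n)
    {f : ℝ → ℝ} (hf : IntegrableOn f unitIco) :
    X.xnorm (logMean n f) ≤ ENNReal.ofReal C * X.xnorm f := by
  have hfm : AEMeasurable (fun t => ENNReal.ofReal |f t|) (volume.restrict unitIco) :=
    (continuous_abs.measurable.comp_aemeasurable hf.1.aemeasurable).ennreal_ofReal
  have hKm : Measurable fun p : ℝ × ℝ =>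
      ENNReal.ofReal |logKernel (pairSeq p.1 p.2) n / harm n| :=
    (continuous_abs.measurable.comp
      ((measurable_logKernel_uncurry n).div_const _)).ennreal_ofReal
  cases X with
  | L1 =>
    calc ∫⁻ x in unitIco, ENNReal.ofReal |logMean n f x|
        ≤ ∫⁻ x in unitIco, ∫⁻ t in unitIco,
          ENNReal.ofReal |f t| * ENNReal.ofReal |logKernel (pairSeq x t) n / harm n| :=
          lintegral_mono fun x => ofReal_abs_logMean_le hf n x
      _ = ∫⁻ t in unitIco, ∫⁻ x in unitIco,
          ENNReal.ofReal |f t| * ENNReal.ofReal |logKernel (pairSeq x t) n / harm n| :=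
          lintegral_lintegral_swap (hfm.comp_snd.mul hKm.aemeasurable)
      _ ≤ ∫⁻ t in unitIco, ENNReal.ofReal |f t| * ENNReal.ofReal C := by
          refine lintegral_mono fun t => ?_
          rw [lintegral_const_mul' _ _ ENNReal.ofReal_ne_top]
          gcongr
          -- After Tonelli the inner integral runs over `x`; symmetry of the kernel turns it into
          -- the assumed bound at the point `t`.
          simp only [pairSeq_comm _ t]
          exact lintegral_logKernel_le hn t (hC t)
      _ = ENNReal.ofReal C * ∫⁻ t in unitIco, ENNReal.ofReal |f t| := by
          rw [lintegral_mul_const' _ _ ENNReal.ofReal_ne_top, mul_comm]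
  | Cw =>
    refine iSup₂_le fun x _ => (ofReal_abs_logMean_le hf n x).trans ?_
    have hKx : Measurable fun t => ENNReal.ofReal |logKernel (pairSeq x t) n / harm n| :=
      (continuous_abs.measurable.comp
        ((isBddMeas_logKernel x n).1.div_const _)).ennreal_ofReal
    have hle : ∀ t ∈ unitIco, ENNReal.ofReal |f t| ≤ Space.Cw.xnorm f := fun t ht =>
      le_iSup₂ (f := fun x (_ : x ∈ unitIco) => ENNReal.ofReal |f x|) t ht
    generalize Space.Cw.xnorm f = S at hle ⊢
    have h1 := setLIntegral_mono' (μ := volume) measurableSet_unitIco fun t ht =>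
      mul_le_mul_left (hle t ht) (ENNReal.ofReal |logKernel (pairSeq x t) n / harm n|)
    refine h1.trans ?_
    rw [lintegral_const_mul S hKx, mul_comm]
    exact mul_le_mul_left (lintegral_logKernel_le hn x (hC x)) S

/-! ### Dyadic continuity and density of Walsh polynomials -/

theorem digit_eq_floor (x : ℝ) {k N : ℕ} (h : k < N) :
    digit x k = ⌊x * 2 ^ N⌋₊ / 2 ^ (N - (k + 1)) % 2 := by
  have : x * 2 ^ (k + 1) = x * 2 ^ N / (2 ^ (N - (k + 1)) : ℕ) := by
    push_cast
    rw [eq_div_iff (by positivity), mul_assoc, ← pow_add]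
    congr 2
    omega
  rw [digit, this, Nat.floor_div_natCast]

theorem floor_mul_two_pow_succ (x : ℝ) (k : ℕ) :
    ⌊x * 2 ^ (k + 1)⌋₊ = 2 * ⌊x * 2 ^ k⌋₊ + digit x k := by
  have : x * 2 ^ k = x * 2 ^ (k + 1) / (2 : ℕ) := by push_cast; rw [pow_succ]; ring
  rw [this, Nat.floor_div_natCast, digit]
  omega

theorem floor_eq_of_digit_eq {x y : ℝ} (hx : x ∈ unitIco) (hy : y ∈ unitIco) {N : ℕ}
    (h : ∀ k < N, digit x k = digit y k) : ⌊x * 2 ^ N⌋₊ = ⌊y * 2 ^ N⌋₊ := by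
  induction N with
  | zero =>
    rw [pow_zero, mul_one, mul_one, Nat.floor_eq_zero.2 hx.2, Nat.floor_eq_zero.2 hy.2]
  | succ N ih =>
    rw [floor_mul_two_pow_succ, floor_mul_two_pow_succ, ih fun k hk => h k (by omega),
      h N (Nat.lt_succ_self N)]

theorem abs_sub_lt_of_digit_eq {x y : ℝ} (hx : x ∈ unitIco) (hy : y ∈ unitIco) {N : ℕ}
    (h : ∀ k < N, digit x k = digit y k) : |x - y| < (1 / 2) ^ N := by
  have h0 := floor_eq_of_digit_eq hx hy h
  have hp : (0 : ℝ) < 2 ^ N := by positivity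
  have h1 := Nat.floor_le (mul_nonneg hx.1 hp.le)
  have h2 := Nat.floor_le (mul_nonneg hy.1 hp.le)
  have h3 := Nat.lt_floor_add_one (x * 2 ^ N)
  have h4 := Nat.lt_floor_add_one (y * 2 ^ N)
  rw [h0] at h1 h3
  have h5 : |x - y| * 2 ^ N = |x * 2 ^ N - y * 2 ^ N| := by
    rw [← sub_mul, abs_mul, abs_of_pos hp]
  rw [div_pow, one_pow, lt_div_iff₀ hp, h5, abs_lt]
  constructor <;> linarith

theorem digit_le_one (x : ℝ) (k : ℕ) : digit x k ≤ 1 := by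
  unfold digit; omega

theorem abs_digit_sub_le (x y : ℝ) (k : ℕ) : |(digit x k : ℝ) - digit y k| ≤ 1 := by
  have h1 : (digit x k : ℝ) ≤ 1 := by exact_mod_cast digit_le_one x k
  have h2 : (digit y k : ℝ) ≤ 1 := by exact_mod_cast digit_le_one y k
  have h3 : (0 : ℝ) ≤ digit x k := Nat.cast_nonneg _
  have h4 : (0 : ℝ) ≤ digit y k := Nat.cast_nonneg _
  rw [abs_le]
  constructor <;> linarith

theorem dyadicAdd_le_of_digit_eq {x y : ℝ} {N : ℕ} (h : ∀ k < N, digit x k = digit y k) :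
    dyadicAdd x y ≤ (1 / 2) ^ N := by
  have key : ∀ n, ∑ k ∈ Finset.range (N + n),
      |(digit x k : ℝ) - digit y k| / 2 ^ (k + 1) ≤ (1 / 2) ^ N - (1 / 2) ^ (N + n) := by
    intro n
    induction n with
    | zero =>
      rw [add_zero, sub_self]
      refine (Finset.sum_eq_zero fun k hk => ?_).le
      rw [h k (Finset.mem_range.1 hk)]; simp
    | succ n ih =>
      rw [← add_assoc, Finset.sum_range_succ]
      have h1 : |(digit x (N + n) : ℝ) - digit y (N + n)| / 2 ^ (N + n + 1) ≤
          (1 / 2) ^ (N + n + 1) := by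
        rw [div_pow, one_pow]
        exact div_le_div_of_nonneg_right (abs_digit_sub_le _ _ _) (by positivity)
      have h2 : ((1 : ℝ) / 2) ^ (N + n) = 2 * (1 / 2) ^ (N + n + 1) := by rw [pow_succ]; ring
      linarith
  refine Real.tsum_le_of_sum_range_le (fun k => by positivity) fun n => ?_
  refine (Finset.sum_le_sum_of_subset_of_nonneg (Finset.range_mono (Nat.le_add_left n N))
    fun k _ _ => by positivity).trans ((key n).trans ?_)
  linarith [show (0 : ℝ) < (1 / 2) ^ (N + n) by positivity]

theorem digit_eq_of_dyadicAdd_lt {x y : ℝ} {N : ℕ} (h : dyadicAdd x y < (1 / 2) ^ N) :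
    ∀ k < N, digit x k = digit y k := by
  intro k hk
  by_contra hne
  have hsum : Summable fun k => |(digit x k : ℝ) - digit y k| / 2 ^ (k + 1) := by
    refine Summable.of_nonneg_of_le (fun k => by positivity) (fun k => ?_)
      ((summable_geometric_of_lt_one (by norm_num) (by norm_num : (1 : ℝ) / 2 < 1)))
    rw [div_pow, one_pow]
    exact div_le_div₀ zero_le_one (abs_digit_sub_le _ _ _) (by positivity)
      (pow_le_pow_right₀ one_le_two (Nat.le_succ k))
  have h1 := hsum.le_tsum k fun j _ => by positivity
  have h2 : |(digit x k : ℝ) - digit y k| = 1 := by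
    have hx := digit_le_one x k
    have hy := digit_le_one y k
    have : digit x k = 0 ∧ digit y k = 1 ∨ digit x k = 1 ∧ digit y k = 0 := by omega
    rcases this with ⟨ha, hb⟩ | ⟨ha, hb⟩ <;> simp [ha, hb]
  rw [h2] at h1
  have h3 : ((1 : ℝ) / 2) ^ N ≤ 1 / 2 ^ (k + 1) := by
    rw [div_pow, one_pow]
    exact one_div_le_one_div_of_le (by positivity) (pow_le_pow_right₀ one_le_two hk)
  exact absurd (h1.trans_lt h) (not_lt.2 h3)

/-- The left endpoint of the dyadic interval of length `2^{-N}` that contains `x`. -/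
noncomputable def dyadicFloor (N : ℕ) (x : ℝ) : ℝ := (⌊x * 2 ^ N⌋₊ : ℝ) / 2 ^ N

theorem dyadicFloor_mem (N : ℕ) {x : ℝ} (hx : x ∈ unitIco) : dyadicFloor N x ∈ unitIco := by
  have hp : (0 : ℝ) < 2 ^ N := by positivity
  refine ⟨by unfold dyadicFloor; positivity, ?_⟩
  rw [dyadicFloor, div_lt_one hp]
  have := Nat.floor_le (mul_nonneg hx.1 hp.le)
  nlinarith [hx.2]

theorem digit_dyadicFloor (x : ℝ) {k N : ℕ} (h : k < N) :
    digit (dyadicFloor N x) k = digit x k := by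
  have : dyadicFloor N x * 2 ^ N = (⌊x * 2 ^ N⌋₊ : ℝ) :=
    div_mul_cancel₀ _ (by positivity)
  rw [digit_eq_floor _ h, digit_eq_floor _ h, this, Nat.floor_natCast]

theorem measurable_comp_dyadicFloor (N : ℕ) (f : ℝ → ℝ) :
    Measurable fun x => f (dyadicFloor N x) :=
  (measurable_from_nat (f := fun n : ℕ => f ((n : ℝ) / 2 ^ N))).comp
    (Nat.measurable_floor.comp (measurable_id.mul_const _))

theorem exists_bound_comp_dyadicFloor (N : ℕ) (f : ℝ → ℝ) :
    ∃ C, ∀ x ∈ unitIco, |f (dyadicFloor N x)| ≤ C := by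
  refine ⟨∑ j ∈ Finset.range (2 ^ N), |f ((j : ℝ) / 2 ^ N)|, fun x hx => ?_⟩
  refine Finset.single_le_sum (f := fun j : ℕ => |f ((j : ℝ) / 2 ^ N)|)
    (fun j _ => abs_nonneg _) (Finset.mem_range.2 ?_)
  have hp : (0 : ℝ) < 2 ^ N := by positivity
  rw [Nat.floor_lt (mul_nonneg hx.1 hp.le)]
  push_cast
  nlinarith [hx.2]

/-- Dyadic uniform continuity in terms of digits. -/
theorem mem_Cw_iff (f : ℝ → ℝ) : Space.Cw.Mem f ↔ ∀ ε > 0, ∃ N, ∀ x ∈ unitIco, ∀ y ∈ unitIco,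
    (∀ k < N, digit x k = digit y k) → |f x - f y| < ε := by
  constructor
  · intro h ε hε
    obtain ⟨δ, hδ, h⟩ := h ε hε
    obtain ⟨N, hN⟩ := exists_pow_lt_of_lt_one hδ (by norm_num : (1 : ℝ) / 2 < 1)
    exact ⟨N, fun x hx y hy hxy => h x hx y hy ((dyadicAdd_le_of_digit_eq hxy).trans_lt hN)⟩
  · intro h ε hε
    obtain ⟨N, h⟩ := h ε hε
    exact ⟨(1 / 2) ^ N, by positivity, fun x hx y hy hxy =>
      h x hx y hy (digit_eq_of_dyadicAdd_lt hxy)⟩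

theorem exists_bound_of_mem_Cw {f : ℝ → ℝ} (hf : Space.Cw.Mem f) :
    ∃ C, ∀ x ∈ unitIco, |f x| ≤ C := by
  obtain ⟨N, hN⟩ := (mem_Cw_iff f).1 hf 1 one_pos
  obtain ⟨C, hC⟩ := exists_bound_comp_dyadicFloor N f
  refine ⟨C + 1, fun x hx => ?_⟩
  have h1 := hN x hx _ (dyadicFloor_mem N hx) fun k hk => (digit_dyadicFloor x hk).symm
  have h2 := abs_sub_abs_le_abs_sub (f x) (f (dyadicFloor N x))
  linarith [hC x hx]

/-- A function in `C_w` is the pointwise limit on `[0,1)` of its samples at dyadic left endpoints.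
These are measurable step functions, so the function itself is measurable, and it is bounded. -/
theorem integrableOn_of_mem (X : Space) {f : ℝ → ℝ} (hf : X.Mem f) : IntegrableOn f unitIco := by
  cases X with
  | L1 => exact hf
  | Cw =>
    have hm : AEMeasurable f (volume.restrict unitIco) := by
      refine aemeasurable_of_tendsto_metrizable_ae' (f := fun N x => f (dyadicFloor N x))
        (fun N => (measurable_comp_dyadicFloor N f).aemeasurable) ?_
      refine (ae_restrict_iff' measurableSet_unitIco).2 (ae_of_all _ fun x hx => ?_)
      rw [Metric.tendsto_atTop]
      intro ε hε
      obtain ⟨N, hN⟩ := (mem_Cw_iff f).1 hf ε hε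
      exact ⟨N, fun n hn => hN _ (dyadicFloor_mem n hx) x hx fun k hk =>
        digit_dyadicFloor x (hk.trans_le hn)⟩
    obtain ⟨C, hC⟩ := exists_bound_of_mem_Cw hf
    exact Integrable.of_bound hm.aestronglyMeasurable C
      ((ae_restrict_iff' measurableSet_unitIco).2 (ae_of_all _ hC))

theorem xnorm_ne_top_of_mem (X : Space) {f : ℝ → ℝ} (hf : X.Mem f) : X.xnorm f ≠ ⊤ := by
  cases X with
  | L1 =>
    have h : ∫⁻ x in unitIco, ‖f x‖ₑ < ⊤ := hf.2
    simp only [Real.enorm_eq_ofReal_abs] at h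
    exact h.ne
  | Cw =>
    obtain ⟨C, hC⟩ := exists_bound_of_mem_Cw hf
    exact ne_top_of_le_ne_top ENNReal.ofReal_ne_top (Space.Cw.xnorm_le_ofReal hC)

theorem digit_eq_of_rademacher_mul_eq_one {x t : ℝ} {k : ℕ} (h : pairSeq x t k = 1) :
    digit x k = digit t k := by
  have hx : digit x k = 0 ∨ digit x k = 1 := by have := digit_le_one x k; omega
  have ht : digit t k = 0 ∨ digit t k = 1 := by have := digit_le_one t k; omega
  unfold pairSeq rademacher at h
  rcases hx with hx | hx <;> rcases ht with ht | ht <;> rw [hx, ht] at h ⊢ <;> norm_num at h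

theorem digit_eq_of_dirichlet_ne_zero {x t : ℝ} {N : ℕ}
    (h : dirichlet (pairSeq x t) (2 ^ N) ≠ 0) : ∀ k < N, digit t k = digit x k := by
  intro k hk
  rw [dirichlet_two_pow] at h
  have h1 := Finset.prod_ne_zero_iff.1 h k (Finset.mem_range.2 hk)
  refine (digit_eq_of_rademacher_mul_eq_one ((pairSeq_eq x t k).resolve_right fun h2 => h1 ?_)).symm
  rw [h2]; norm_num

/-- `S_{2^N} f (x)` averages `f` over the dyadic interval of `x`: the kernel `D_{2^N}` is
nonnegative, has integral one, and vanishes unless the first `N` digits agree. -/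
theorem abs_partialSum_two_pow_sub_le {f : ℝ → ℝ} (hf : IntegrableOn f unitIco) {N : ℕ} {ε : ℝ}
    (h : ∀ x ∈ unitIco, ∀ y ∈ unitIco, (∀ k < N, digit x k = digit y k) → |f x - f y| ≤ ε)
    {x : ℝ} (hx : x ∈ unitIco) : |partialSum (2 ^ N) f x - f x| ≤ ε := by
  have hD := isBddMeas_dirichlet x (2 ^ N)
  have hI := integral_dirichlet x (n := 2 ^ N) (by positivity)
  have h1 : partialSum (2 ^ N) f x - f x =
      ∫ t in unitIco, (f t - f x) * dirichlet (pairSeq x t) (2 ^ N) := by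
    simp only [sub_mul]
    rw [partialSum_eq_integral hf, integral_sub (hD.integrable_mul hf) (hD.integrable.const_mul _),
      integral_const_mul, hI, mul_one]
  have h2 : ε = ∫ t in unitIco, ε * dirichlet (pairSeq x t) (2 ^ N) := by
    rw [integral_const_mul, hI, mul_one]
  rw [h1, h2, ← Real.norm_eq_abs]
  refine norm_integral_le_of_norm_le (hD.integrable.const_mul ε)
    ((ae_restrict_iff' measurableSet_unitIco).2 (ae_of_all _ fun t ht => ?_))
  rw [Real.norm_eq_abs, abs_mul, abs_of_nonneg (dirichlet_two_pow_nonneg (pairSeq_eq x t) N)]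
  by_cases h0 : dirichlet (pairSeq x t) (2 ^ N) = 0
  · rw [h0, mul_zero, mul_zero]
  · exact mul_le_mul_of_nonneg_right (h t ht x hx (digit_eq_of_dirichlet_ne_zero h0))
      (dirichlet_two_pow_nonneg (pairSeq_eq x t) N)

/-- Walsh polynomials are dense. -/
theorem exists_partialSum_close (X : Space) {f : ℝ → ℝ} (hf : X.Mem f) {ε : ℝ} (hε : 0 < ε) :
    ∃ (M : ℕ) (g : ℝ → ℝ), X.xnorm (fun x => f x - partialSum M g x) ≤ ENNReal.ofReal ε := by
  have hfi := integrableOn_of_mem X hf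
  cases X with
  | Cw =>
    obtain ⟨N, hN⟩ := (mem_Cw_iff f).1 hf ε hε
    refine ⟨2 ^ N, f, Space.Cw.xnorm_le_ofReal fun x hx => ?_⟩
    rw [abs_sub_comm]
    exact abs_partialSum_two_pow_sub_le hfi (fun x hx y hy h => (hN x hx y hy h).le) hx
  | L1 =>
    have hε2 : 0 < ε / 2 := by positivity
    have hind : Integrable (unitIco.indicator f) volume :=
      (integrable_indicator_iff measurableSet_unitIco).2 hfi
    -- A compactly supported continuous approximation is uniformly continuous for the usual
    -- distance, and agreement of `N` digits puts two points within `2^{-N}`.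
    obtain ⟨g, hgs, hgf, hgc, hgi⟩ := hind.exists_hasCompactSupport_lintegral_sub_le
      (ENNReal.ofReal_pos.2 hε2).ne'
    obtain ⟨δ, hδ, hu⟩ := Metric.uniformContinuous_iff.1
      (hgs.uniformContinuous_of_continuous hgc) (ε / 2) hε2
    obtain ⟨N, hN⟩ := exists_pow_lt_of_lt_one hδ (by norm_num : (1 : ℝ) / 2 < 1)
    refine ⟨2 ^ N, g, ?_⟩
    have h1 : Space.L1.xnorm (fun x => f x - g x) ≤ ENNReal.ofReal (ε / 2) := by
      refine le_trans ?_ hgf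
      refine le_trans ?_ (setLIntegral_le_lintegral unitIco _)
      refine (setLIntegral_congr_fun measurableSet_unitIco fun x hx => ?_).le
      simp only [Set.indicator_of_mem hx, Real.enorm_eq_ofReal_abs]
    have h2 : Space.L1.xnorm (fun x => g x - partialSum (2 ^ N) g x) ≤ ENNReal.ofReal (ε / 2) := by
      refine Space.L1.xnorm_le_ofReal fun x hx => ?_
      rw [abs_sub_comm]
      refine abs_partialSum_two_pow_sub_le hgi.integrableOn (fun x hx y hy h => ?_) hx
      exact (hu ((abs_sub_lt_of_digit_eq hx hy h).trans hN)).le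
    have h3 := Space.L1.xnorm_add_le (f := fun x => f x - g x)
      (g := fun x => g x - partialSum (2 ^ N) g x) (hfi.sub hgi.integrableOn).1.aemeasurable
    simp only [sub_add_sub_cancel] at h3
    refine h3.trans ((add_le_add h1 h2).trans_eq ?_)
    rw [← ENNReal.ofReal_add hε2.le hε2.le, add_halves]

/-! ### Convergence on Walsh polynomials and sufficiency -/

theorem coeff_partialSum (M : ℕ) (g : ℝ → ℝ) (i : ℕ) :
    coeff (partialSum M g) i = if i < M then coeff g i else 0 := by
  have h : coeff (partialSum M g) i =
      ∑ j ∈ Finset.range M, coeff g j * ∫ t in unitIco, walsh j t * walsh i t := by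
    simp only [← integral_const_mul]
    rw [← integral_finsetSum _ fun j _ =>
      (((isBddMeas_walsh j).mul (isBddMeas_walsh i)).integrable.const_mul (coeff g j))]
    refine integral_congr_ae (ae_of_all _ fun t => ?_)
    simp only [partialSum, Finset.sum_mul, mul_assoc]
  simp [h, integral_walsh_mul_walsh]

theorem partialSum_partialSum (k M : ℕ) (g : ℝ → ℝ) (x : ℝ) :
    partialSum k (partialSum M g) x = partialSum (min k M) g x := by
  have h : ∀ i, coeff (partialSum M g) i * walsh i x =
      if i < M then coeff g i * walsh i x else 0 := fun i => by
    rw [coeff_partialSum, ite_mul, zero_mul]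
  unfold partialSum at h ⊢
  simp only [h]
  rw [← Finset.sum_filter]
  congr 1
  ext i
  simp

theorem abs_partialSum_le (k : ℕ) {M : ℕ} (g : ℝ → ℝ) (hk : k ≤ M) (x : ℝ) :
    |partialSum k g x| ≤ ∑ i ∈ Finset.range M, |coeff g i| := by
  refine (Finset.abs_sum_le_sum_abs _ _).trans ?_
  simp only [abs_mul, abs_walsh, mul_one]
  exact Finset.sum_le_sum_of_subset_of_nonneg (Finset.range_mono hk) fun _ _ _ => abs_nonneg _

/-- A Walsh polynomial `p` of length `M` satisfies `S_k p = p` for `k ≥ M`. Only the indices below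
`M` contribute, each with weight at most one and difference at most `2B`. -/
theorem abs_logMean_partialSum_sub_le {n : ℕ} (hn : 2 ≤ n) (M : ℕ) (g : ℝ → ℝ) (x : ℝ) :
    |logMean n (partialSum M g) x - partialSum M g x| ≤
      2 * (∑ i ∈ Finset.range M, |coeff g i|) * M / harm n := by
  set B := ∑ i ∈ Finset.range M, |coeff g i| with hB
  have hB0 : 0 ≤ B := Finset.sum_nonneg fun _ _ => abs_nonneg _
  have hl : 0 < harm n := zero_lt_one.trans_le (one_le_harm hn)
  have h1 : logMean n (partialSum M g) x - partialSum M g x = 1 / harm n *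
      ∑ k ∈ Finset.Ico 1 n, (partialSum (min k M) g x - partialSum M g x) / ((n : ℝ) - k) := by
    have : ∑ k ∈ Finset.Ico 1 n, (partialSum (min k M) g x - partialSum M g x) / ((n : ℝ) - k) =
        ∑ k ∈ Finset.Ico 1 n, partialSum (min k M) g x / ((n : ℝ) - k) -
          partialSum M g x * harm n := by
      rw [← harm_reflect, Finset.mul_sum, ← Finset.sum_sub_distrib]
      exact Finset.sum_congr rfl fun k _ => by ring
    rw [this, mul_sub]
    unfold logMean
    simp only [partialSum_partialSum]
    field_simp
  have h2 : ∀ k ∈ Finset.Ico 1 n, |(partialSum (min k M) g x - partialSum M g x) / ((n : ℝ) - k)| ≤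
      if k < M then 2 * B else 0 := by
    intro k hk
    have hkn : (1 : ℝ) ≤ (n : ℝ) - k := by
      have : ((k + 1 : ℕ) : ℝ) ≤ n := by exact_mod_cast (Finset.mem_Ico.1 hk).2
      push_cast at this
      linarith
    split_ifs with hkM
    · rw [abs_div, abs_of_pos (zero_lt_one.trans_le hkn), div_le_iff₀ (zero_lt_one.trans_le hkn)]
      have a1 := abs_partialSum_le (min k M) g (min_le_right k M) x
      have a2 := abs_partialSum_le M g le_rfl x
      have a3 := abs_sub (partialSum (min k M) g x) (partialSum M g x)
      nlinarith
    · rw [min_eq_right (not_lt.1 hkM)]; simp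
  rw [h1, abs_mul, abs_of_pos (one_div_pos.2 hl), one_div, inv_mul_le_iff₀ hl,
    mul_div_cancel₀ _ hl.ne']
  refine (Finset.abs_sum_le_sum_abs _ _).trans ((Finset.sum_le_sum h2).trans ?_)
  rw [← Finset.sum_filter, Finset.sum_const, nsmul_eq_mul, mul_comm]
  refine mul_le_mul_of_nonneg_left ?_ (by positivity)
  have : (Finset.filter (fun k => k < M) (Finset.Ico 1 n)).card ≤ (Finset.range M).card :=
    Finset.card_le_card fun k hk => Finset.mem_range.2 (Finset.mem_filter.1 hk).2
  rw [Finset.card_range] at this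
  exact_mod_cast this

theorem tendsto_harm : Tendsto harm atTop atTop := by
  refine tendsto_atTop_atTop_of_monotone harm_mono fun b => ?_
  obtain ⟨a, ha⟩ := exists_nat_ge (2 * b)
  exact ⟨2 ^ a, by linarith [half_le_harm_two_pow a]⟩

/-- Bounded logarithmic variation implies norm convergence. -/
theorem convergesTo_of_bddAbove (X : Space) {m : ℕ → ℕ} (hm : StrictMono m) (hm2 : ∀ A, 2 ≤ m A)
    (h : BddAbove (Set.range fun A => logVariation (m A))) {f : ℝ → ℝ} (hf : X.Mem f) :
    X.ConvergesTo (fun A => logMean (m A) f) f := by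
  obtain ⟨V, hV⟩ := h
  have hV : ∀ A, logVariation (m A) ≤ V := fun A => hV ⟨A, rfl⟩
  have hV0 : 0 ≤ V := (logVariation_nonneg _).trans (hV 0)
  set C := 6 + 2 * V with hC
  have hker : ∀ A x, absInt (fun t => logKernel (pairSeq x t) (m A)) ≤ C * harm (m A) :=
    fun A x => (absInt_logKernel_le_logVariation x (hm2 A)).trans
      (mul_le_mul_of_nonneg_right (by linarith [hV A]) (harm_nonneg _))
  have hfi := integrableOn_of_mem X hf
  unfold Space.ConvergesTo
  rw [ENNReal.tendsto_nhds_zero]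
  intro ε hε
  obtain ⟨δ, hδ, hδε⟩ : ∃ δ : ℝ, 0 < δ ∧ ENNReal.ofReal δ ≤ ε := by
    obtain ⟨r, hr0, hr⟩ := ENNReal.lt_iff_exists_nnreal_btwn.1 hε
    exact ⟨r, by exact_mod_cast hr0, by rw [ENNReal.ofReal_coe_nnreal]; exact hr.le⟩
  -- The error splits as `L(f - p) + (L p - p) + (p - f)`, with bounds `Cη`, `η` and `η`.
  set η := δ / (C + 2) with hη
  have hη0 : 0 < η := by positivity
  obtain ⟨M, g, hg⟩ := exists_partialSum_close X hf hη0
  set p := partialSum M g with hp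
  have hpB : IsBddMeas p := isBddMeas_partialSum M g
  have hlim : Tendsto (fun A => 2 * (∑ i ∈ Finset.range M, |coeff g i|) * M / harm (m A))
      atTop (𝓝 0) :=
    (tendsto_harm.comp hm.tendsto_atTop).const_div_atTop _
  filter_upwards [hlim.eventually (ge_mem_nhds hη0)] with A hA
  have h1 : X.xnorm (logMean (m A) fun t => f t - p t) ≤ ENNReal.ofReal C * ENNReal.ofReal η :=
    (xnorm_logMean_le X (hm2 A) (hker A) (hfi.sub hpB.integrable)).trans
      (mul_le_mul_right hg _)
  have h2 : X.xnorm (fun x => logMean (m A) p x - p x) ≤ ENNReal.ofReal η :=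
    X.xnorm_le_ofReal fun x _ => (abs_logMean_partialSum_sub_le (hm2 A) M g x).trans hA
  have h3 : X.xnorm (fun x => p x - f x) ≤ ENNReal.ofReal η := by
    rw [X.xnorm_congr (g := fun x => f x - p x) fun x _ => abs_sub_comm _ _]
    exact hg
  have h4 := X.xnorm_add_le (f := logMean (m A) fun t => f t - p t)
    (g := fun x => (logMean (m A) p x - p x) + (p x - f x))
    (isBddMeas_logMean _ _).1.aemeasurable
  have h5 := X.xnorm_add_le (f := fun x => logMean (m A) p x - p x) (g := fun x => p x - f x)
    ((isBddMeas_logMean _ _).sub hpB).1.aemeasurable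
  have h6 : (fun x => logMean (m A) (fun t => f t - p t) x +
      ((logMean (m A) p x - p x) + (p x - f x))) = fun x => logMean (m A) f x - f x := by
    funext x
    rw [logMean_sub hfi hpB.integrable]
    ring
  rw [h6] at h4
  refine le_trans (h4.trans (add_le_add h1 (h5.trans (add_le_add h2 h3)))) (le_trans ?_ hδε)
  rw [← ENNReal.ofReal_mul (by linarith), ← ENNReal.ofReal_add hη0.le hη0.le,
    ← ENNReal.ofReal_add (by positivity) (by positivity)]
  refine ENNReal.ofReal_le_ofReal (le_of_eq ?_)
  have hC2 : C + 2 ≠ 0 := by positivity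
  rw [hη]
  field_simp
  ring

/-! ### Necessity through Banach–Steinhaus -/

/-- Convergence bounds only a tail of the sequence; the remaining terms have finite norm because
each function is bounded. -/
theorem exists_xnorm_bound (X : Space) {u : ℕ → ℝ → ℝ} (hu : ∀ A, IsBddMeas (u A)) {g : ℝ → ℝ}
    (hg : X.Mem g) (h : X.ConvergesTo u g) :
    ∃ C : ℝ, ∀ A, X.xnorm (u A) ≤ ENNReal.ofReal C := by
  have hfin : ∀ A, X.xnorm (u A) ≠ ⊤ := fun A => by
    obtain ⟨C, hC⟩ := (hu A).2
    exact ne_top_of_le_ne_top ENNReal.ofReal_ne_top (X.xnorm_le_ofReal fun x _ => hC x)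
  have hgt : X.xnorm g + 1 ≠ ⊤ := by simpa using xnorm_ne_top_of_mem X hg
  have hev : ∀ᶠ A in atTop, (X.xnorm (u A)).toReal ≤ (X.xnorm g + 1).toReal := by
    filter_upwards [ENNReal.tendsto_nhds_zero.1 h 1 one_pos] with A hA
    refine ENNReal.toReal_mono hgt ?_
    have := X.xnorm_add_le (f := g) (g := fun x => u A x - g x)
      (integrableOn_of_mem X hg).1.aemeasurable
    simp only [add_sub_cancel] at this
    exact this.trans (by gcongr)
  obtain ⟨C, hC⟩ := IsBoundedUnder.bddAbove_range
    (f := fun A => (X.xnorm (u A)).toReal) ⟨_, eventually_map.2 hev⟩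
  exact ⟨C, fun A => by
    rw [← ENNReal.ofReal_toReal (hfin A)]
    exact ENNReal.ofReal_le_ofReal (hC ⟨A, rfl⟩)⟩

theorem exists_uniform_bound {E : Type*} [NormedAddCommGroup E] [NormedSpace ℝ E]
    [CompleteSpace E] (Λ : ℕ → E →ₗ[ℝ] ℝ) (hcont : ∀ A, ∃ C, ∀ f, |Λ A f| ≤ C * ‖f‖)
    (hbdd : ∀ f, ∃ C, ∀ A, |Λ A f| ≤ C) : ∃ C, 0 ≤ C ∧ ∀ A f, |Λ A f| ≤ C * ‖f‖ := by
  choose K hK using hcont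
  obtain ⟨C, hC⟩ := banach_steinhaus (g := fun A => (Λ A).mkContinuous (K A) (hK A))
    (fun f => hbdd f)
  refine ⟨C, (norm_nonneg _).trans (hC 0), fun A f => ?_⟩
  exact ((Λ A).mkContinuous (K A) (hK A)).le_of_opNorm_le (hC A) f

/-- Makes the means independent of the representative chosen for an element of `Lp`. -/
theorem logMean_congr_coeff {f g : ℝ → ℝ} (h : ∀ i, coeff f i = coeff g i) (n : ℕ) :
    logMean n f = logMean n g := by
  funext x
  simp only [logMean, partialSum, h]

theorem coeff_congr_ae {f g : ℝ → ℝ} (h : f =ᵐ[volume.restrict unitIco] g) (i : ℕ) :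
    coeff f i = coeff g i :=
  integral_congr_ae (h.mono fun t ht => by simp only [ht])

theorem logMean_add {f g : ℝ → ℝ} (hf : IntegrableOn f unitIco) (hg : IntegrableOn g unitIco)
    (n : ℕ) (x : ℝ) : logMean n (fun t => f t + g t) x = logMean n f x + logMean n g x := by
  have hfg : IntegrableOn (fun t => f t + g t) unitIco := hf.add hg
  rw [logMean_eq_integral hf, logMean_eq_integral hg, logMean_eq_integral hfg, ← mul_add,
    ← integral_add ((isBddMeas_logKernel x n).integrable_mul hf)
      ((isBddMeas_logKernel x n).integrable_mul hg)]
  simp only [add_mul]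

theorem logMean_const_mul {f : ℝ → ℝ} (hf : IntegrableOn f unitIco) (c : ℝ) (n : ℕ) (x : ℝ) :
    logMean n (fun t => c * f t) x = c * logMean n f x := by
  have hcf : IntegrableOn (fun t => c * f t) unitIco := hf.const_mul c
  rw [logMean_eq_integral hf, logMean_eq_integral hcf]
  simp only [mul_assoc, integral_const_mul]
  ring

/-- A continuous substitute for the sign of `v`. -/
noncomputable def softSign (v : ℝ) : ℝ := v / (|v| + 1)

theorem continuous_softSign : Continuous softSign :=
  continuous_id.div (continuous_abs.add continuous_const) fun v => by positivity

theorem abs_softSign_le (v : ℝ) : |softSign v| ≤ 1 := by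
  have h : 0 < |v| + 1 := by positivity
  rw [softSign, abs_div, abs_of_pos h, div_le_one h]
  linarith

/-- The loss of `1` is harmless because it is later divided by `l_n ≥ 1`. -/
theorem abs_sub_one_le_mul_softSign (v : ℝ) : |v| - 1 ≤ v * softSign v := by
  have h : 0 < |v| + 1 := by positivity
  rw [softSign, mul_div_assoc', le_div_iff₀ h]
  nlinarith [abs_mul_abs_self v]

theorem isBddMeas_softSign_logKernel (n : ℕ) :
    IsBddMeas fun x => softSign (logKernel (pairSeq 0 x) n) :=
  ⟨continuous_softSign.measurable.comp (isBddMeas_logKernel 0 n).1, 1, fun _ => abs_softSign_le _⟩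

theorem absInt_sub_one_le_integral (n : ℕ) :
    absInt (fun t => logKernel (pairSeq 0 t) n) - 1 ≤
      ∫ t in unitIco, logKernel (pairSeq 0 t) n * softSign (logKernel (pairSeq 0 t) n) := by
  have hK := isBddMeas_logKernel 0 n
  have h := integral_mono (hK.abs.sub (IsBddMeas.const 1)).integrable
    (hK.mul (isBddMeas_softSign_logKernel n)).integrable fun t => abs_sub_one_le_mul_softSign _
  rw [integral_sub hK.abs.integrable (IsBddMeas.const 1).integrable] at h
  simpa [absInt, unitIco] using h

theorem exists_absInt_logKernel_le {n : ℕ} (hn : 2 ≤ n) :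
    ∃ C, ∀ x, absInt (fun t => logKernel (pairSeq x t) n) ≤ C * harm n :=
  ⟨_, fun x => absInt_logKernel_le_logVariation x hn⟩

theorem absInt_logKernel_le_of_sub_one_le {n : ℕ} (hn : 2 ≤ n) {C : ℝ}
    (h : 1 / harm n * (absInt (fun t => logKernel (pairSeq 0 t) n) - 1) ≤ C) :
    absInt (fun t => logKernel (pairSeq 0 t) n) ≤ (C + 1) * harm n := by
  have hl := one_le_harm hn
  rw [one_div, inv_mul_le_iff₀ (by linarith)] at h
  linarith

section L1

theorem integrableOn_coe (f : Lp ℝ 1 (volume.restrict unitIco)) : IntegrableOn f unitIco :=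
  L1.integrable_coeFn f

/-- The functional `f ↦ ∫ L_n(f) σ` with `σ` the regularized sign of the kernel of `L_n` at `0`. -/
noncomputable def signFunctional (n : ℕ) : Lp ℝ 1 (volume.restrict unitIco) →ₗ[ℝ] ℝ where
  toFun f := ∫ x in unitIco, logMean n f x * softSign (logKernel (pairSeq 0 x) n)
  map_add' f g := by
    have hσ := isBddMeas_softSign_logKernel n
    rw [logMean_congr_coeff (coeff_congr_ae (Lp.coeFn_add f g)) n,
      ← integral_add ((isBddMeas_logMean n f).mul hσ).integrable
        ((isBddMeas_logMean n g).mul hσ).integrable]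
    refine integral_congr_ae (ae_of_all _ fun x => ?_)
    have := logMean_add (integrableOn_coe f) (integrableOn_coe g) n x
    simp only [← add_mul, ← this]
    rfl
  map_smul' c f := by
    rw [logMean_congr_coeff (coeff_congr_ae (Lp.coeFn_smul c f)) n, RingHom.id_apply, smul_eq_mul,
      ← integral_const_mul]
    refine integral_congr_ae (ae_of_all _ fun x => ?_)
    have := logMean_const_mul (integrableOn_coe f) c n x
    simp only [← mul_assoc, ← this]
    rfl

theorem abs_signFunctional_le (n : ℕ) (f : Lp ℝ 1 (volume.restrict unitIco)) :
    |signFunctional n f| ≤ absInt (logMean n f) := by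
  have hL := isBddMeas_logMean n f
  refine abs_integral_le_integral_abs.trans
    (integral_mono (hL.mul (isBddMeas_softSign_logKernel n)).abs.integrable hL.abs.integrable
      fun x => ?_)
  simp only [abs_mul]
  exact mul_le_of_le_one_right (abs_nonneg _) (abs_softSign_le _)

theorem xnorm_L1_eq {h : ℝ → ℝ} (hh : IsBddMeas h) :
    Space.L1.xnorm h = ENNReal.ofReal (absInt h) :=
  (ofReal_integral_eq_lintegral_ofReal hh.abs.integrable (ae_of_all _ fun _ => abs_nonneg _)).symm

/-- `D_{2^n}` acts as a point mass at `0`: `L_n` sees only frequencies below `n < 2^n`, where the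
coefficients agree with those of the point mass. Since it has norm one in `L₁`, it is a test element
that recovers the kernel. -/
theorem logMean_dirichlet (n : ℕ) (x : ℝ) :
    logMean n (fun t => dirichlet (pairSeq 0 t) (2 ^ n)) x =
      1 / harm n * logKernel (pairSeq 0 x) n := by
  have hc : ∀ i < n, coeff (fun t => dirichlet (pairSeq 0 t) (2 ^ n)) i = walsh i 0 := by
    intro i hi
    have h1 : coeff (fun t => dirichlet (pairSeq 0 t) (2 ^ n)) i =
        ∑ j ∈ Finset.range (2 ^ n), walsh j 0 * ∫ t in unitIco, walsh j t * walsh i t := by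
      simp only [← integral_const_mul]
      rw [← integral_finsetSum _ fun j _ =>
        (((isBddMeas_walsh j).mul (isBddMeas_walsh i)).integrable.const_mul (walsh j 0))]
      refine integral_congr_ae (ae_of_all _ fun t => ?_)
      simp only [dirichlet, walshProd_pairSeq, Finset.sum_mul, mul_assoc]
    simp [h1, integral_walsh_mul_walsh, hi.trans n.lt_two_pow_self]
  unfold logMean logKernel
  congr 1
  refine Finset.sum_congr rfl fun k hk => ?_
  congr 1
  refine Finset.sum_congr rfl fun i hi => ?_
  rw [hc i ((Finset.mem_range.1 hi).trans (Finset.mem_Ico.1 hk).2), walshProd_pairSeq]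

theorem exists_kernel_bound_of_L1 {m : ℕ → ℕ} (hm2 : ∀ A, 2 ≤ m A)
    (h : ∀ f : ℝ → ℝ, Space.L1.Mem f →
      ∃ C : ℝ, ∀ A, Space.L1.xnorm (logMean (m A) f) ≤ ENNReal.ofReal C) :
    ∃ C, 0 ≤ C ∧ ∀ A, absInt (fun t => logKernel (pairSeq 0 t) (m A)) ≤ C * harm (m A) := by
  obtain ⟨C, hC0, hC⟩ := exists_uniform_bound (fun A => signFunctional (m A)) (fun A => by
      obtain ⟨C, hC⟩ := exists_absInt_logKernel_le (hm2 A)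
      have hC0 : 0 ≤ C := by
        have := (absInt_nonneg _).trans (hC 0)
        exact nonneg_of_mul_nonneg_left this (by linarith [one_le_harm (hm2 A)])
      refine ⟨C, fun f => (abs_signFunctional_le _ f).trans ?_⟩
      have h1 := xnorm_logMean_le Space.L1 (hm2 A) hC (integrableOn_coe f)
      have h2 : Space.L1.xnorm f = ENNReal.ofReal ‖f‖ := by
        rw [L1.ofReal_norm_eq_lintegral]
        simp only [Real.enorm_eq_ofReal_abs]
        rfl
      rw [xnorm_L1_eq (isBddMeas_logMean _ _), h2, ← ENNReal.ofReal_mul hC0] at h1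
      exact (ENNReal.ofReal_le_ofReal_iff (by positivity)).1 h1) (fun f => by
    obtain ⟨C, hC⟩ := h f (integrableOn_coe f)
    refine ⟨max C 0, fun A => (abs_signFunctional_le _ f).trans ?_⟩
    have h1 := (hC A).trans (ENNReal.ofReal_le_ofReal (le_max_left C 0))
    rw [xnorm_L1_eq (isBddMeas_logMean _ _)] at h1
    exact (ENNReal.ofReal_le_ofReal_iff (le_max_right C 0)).1 h1)
  refine ⟨C + 1, by linarith, fun A => absInt_logKernel_le_of_sub_one_le (hm2 A) ?_⟩
  have hD := isBddMeas_dirichlet 0 (2 ^ m A)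
  have hDi : Integrable (fun t => dirichlet (pairSeq 0 t) (2 ^ m A)) (volume.restrict unitIco) :=
    hD.integrable
  set φ := hDi.toL1 (fun t => dirichlet (pairSeq 0 t) (2 ^ m A)) with hφ
  have hnorm : ‖φ‖ = 1 := by
    rw [hφ, L1.norm_of_fun_eq_integral_norm]
    exact absInt_dirichlet_two_pow 0 (m A)
  -- Pairing the recovered kernel with its regularized sign gives its `L₁` norm up to the loss of
  -- `1`.
  have hval : signFunctional (m A) φ = 1 / harm (m A) * ∫ t in unitIco,
      logKernel (pairSeq 0 t) (m A) * softSign (logKernel (pairSeq 0 t) (m A)) := by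
    change ∫ x in unitIco, logMean (m A) φ x * softSign (logKernel (pairSeq 0 x) (m A)) = _
    rw [logMean_congr_coeff (coeff_congr_ae (Integrable.coeFn_toL1 hDi)) (m A),
      ← integral_const_mul]
    simp only [logMean_dirichlet, mul_assoc]
  have h1 := (le_abs_self _).trans (hC A φ)
  simp only [hnorm, mul_one, hval] at h1
  exact (mul_le_mul_of_nonneg_left (absInt_sub_one_le_integral (m A))
    (one_div_nonneg.2 (harm_nonneg _))).trans h1

end L1

section Cw

/-- The sequence of binary digits of `x`, a point of the Cantor space. -/
noncomputable def digits (x : ℝ) (k : ℕ) : Bool := decide (digit x k = 1)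

/-- Continuous functions on the compact Cantor space give a complete normed space of members of
`C_w`, on which Banach–Steinhaus can be applied. -/
theorem mem_Cw_comp_digits (φ : C(ℕ → Bool, ℝ)) : Space.Cw.Mem fun x => φ (digits x) := by
  rw [mem_Cw_iff]
  intro ε hε
  -- In this metric, points agreeing in the first `N` coordinates are at distance at most `2^{-N}`.
  let _ : MetricSpace (ℕ → Bool) := PiNat.metricSpaceOfDiscreteUniformity fun _ => rfl
  obtain ⟨δ, hδ, hu⟩ := Metric.uniformContinuous_iff.1
    (CompactSpace.uniformContinuous_of_continuous φ.continuous) ε hε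
  obtain ⟨N, hN⟩ := exists_pow_lt_of_lt_one hδ (by norm_num : (1 : ℝ) / 2 < 1)
  refine ⟨N, fun x _ y _ hxy => hu ?_⟩
  refine lt_of_le_of_lt (PiNat.mem_cylinder_iff_dist_le.1 ?_) hN
  intro k hk
  simp only [digits, hxy k hk]

theorem abs_apply_zero_le {h : ℝ → ℝ} {C : ℝ} (hC : Space.Cw.xnorm h ≤ ENNReal.ofReal C) :
    |h 0| ≤ max C 0 := by
  have h0 : (0 : ℝ) ∈ unitIco := ⟨le_rfl, one_pos⟩
  have h1 : ENNReal.ofReal |h 0| ≤ Space.Cw.xnorm h :=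
    le_iSup₂ (f := fun x (_ : x ∈ unitIco) => ENNReal.ofReal |h x|) 0 h0
  exact (ENNReal.ofReal_le_ofReal_iff (le_max_right C 0)).1
    (h1.trans (hC.trans (ENNReal.ofReal_le_ofReal (le_max_left C 0))))

theorem integrableOn_comp_digits (φ : C(ℕ → Bool, ℝ)) :
    IntegrableOn (fun x => φ (digits x)) unitIco :=
  integrableOn_of_mem Space.Cw (mem_Cw_comp_digits φ)

/-- The functional `f ↦ L_n(f)(0)` on continuous functions on the Cantor space. -/
noncomputable def evalFunctional (n : ℕ) : C(ℕ → Bool, ℝ) →ₗ[ℝ] ℝ where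
  toFun φ := logMean n (fun x => φ (digits x)) 0
  map_add' φ ψ := logMean_add (integrableOn_comp_digits φ) (integrableOn_comp_digits ψ) n 0
  map_smul' c φ := logMean_const_mul (integrableOn_comp_digits φ) c n 0

/-- The values of the Rademacher functions in terms of digits. -/
noncomputable def signSeq (b : ℕ → Bool) (k : ℕ) : ℝ := if b k then -1 else 1

theorem signSeq_digits (x : ℝ) : signSeq (digits x) = pairSeq 0 x := by
  funext k
  have h0 : digit 0 k = 0 := by simp [digit]
  have h : digit x k = 0 ∨ digit x k = 1 := by have := digit_le_one x k; omega
  rcases h with h | h <;> simp [signSeq, digits, pairSeq, rademacher, h0, h]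

theorem continuous_logKernel_signSeq (n : ℕ) : Continuous fun b => logKernel (signSeq b) n := by
  have h : ∀ k, Continuous fun b => signSeq b k := fun k =>
    (continuous_of_discreteTopology (f := fun c : Bool => if c then (-1 : ℝ) else 1)).comp
      (continuous_apply k)
  unfold logKernel dirichlet walshProd
  refine continuous_finsetSum _ fun k _ => Continuous.div_const ?_ _
  exact continuous_finsetSum _ fun i _ => continuous_finsetProd _ fun j _ => (h j).pow _

theorem exists_kernel_bound_of_Cw {m : ℕ → ℕ} (hm2 : ∀ A, 2 ≤ m A)
    (h : ∀ f : ℝ → ℝ, Space.Cw.Mem f →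
      ∃ C : ℝ, ∀ A, Space.Cw.xnorm (logMean (m A) f) ≤ ENNReal.ofReal C) :
    ∃ C, 0 ≤ C ∧ ∀ A, absInt (fun t => logKernel (pairSeq 0 t) (m A)) ≤ C * harm (m A) := by
  obtain ⟨C, hC0, hC⟩ := exists_uniform_bound (fun A => evalFunctional (m A)) (fun A => by
      obtain ⟨C, hC⟩ := exists_absInt_logKernel_le (hm2 A)
      have hC0 : 0 ≤ C := by
        have := (absInt_nonneg _).trans (hC 0)
        exact nonneg_of_mul_nonneg_left this (by linarith [one_le_harm (hm2 A)])
      refine ⟨C, fun φ => ?_⟩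
      have h1 := xnorm_logMean_le Space.Cw (hm2 A) hC (integrableOn_comp_digits φ)
      have h2 : Space.Cw.xnorm (fun x => φ (digits x)) ≤ ENNReal.ofReal ‖φ‖ :=
        Space.Cw.xnorm_le_ofReal fun x _ => φ.norm_coe_le_norm (digits x)
      have h3 := h1.trans (mul_le_mul_right h2 _)
      rw [← ENNReal.ofReal_mul hC0] at h3
      exact (abs_apply_zero_le h3).trans_eq (max_eq_left (by positivity))) (fun φ => by
    obtain ⟨C, hC⟩ := h _ (mem_Cw_comp_digits φ)
    exact ⟨max C 0, fun A => abs_apply_zero_le (hC A)⟩)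
  refine ⟨C + 1, by linarith, fun A => absInt_logKernel_le_of_sub_one_le (hm2 A) ?_⟩
  -- The exact sign of the kernel need not be continuous, whereas its soft sign is a continuous
  -- function on the Cantor space of norm at most one.
  set φ : C(ℕ → Bool, ℝ) := ⟨fun b => softSign (logKernel (signSeq b) (m A)),
    continuous_softSign.comp (continuous_logKernel_signSeq (m A))⟩ with hφ
  have hnorm : ‖φ‖ ≤ 1 := (ContinuousMap.norm_le φ zero_le_one).2 fun b => abs_softSign_le _
  have hval : evalFunctional (m A) φ = 1 / harm (m A) * ∫ t in unitIco,
      logKernel (pairSeq 0 t) (m A) * softSign (logKernel (pairSeq 0 t) (m A)) := by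
    change logMean (m A) (fun x => φ (digits x)) 0 = _
    rw [logMean_eq_integral (integrableOn_comp_digits φ)]
    simp only [hφ, ContinuousMap.coe_mk, signSeq_digits, mul_comm (softSign _)]
  have h1 := ((le_abs_self _).trans (hC A φ)).trans (mul_le_of_le_one_right hC0 hnorm)
  simp only [hval] at h1
  exact (mul_le_mul_of_nonneg_left (absInt_sub_one_le_integral (m A))
    (one_div_nonneg.2 (harm_nonneg _))).trans h1

end Cw

/-- Norm convergence for all functions implies bounded logarithmic variation. -/
theorem bddAbove_of_forall_convergesTo (X : Space) {m : ℕ → ℕ} (hm2 : ∀ A, 2 ≤ m A)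
    (h : ∀ f : ℝ → ℝ, X.Mem f →
      ∃ g : ℝ → ℝ, X.Mem g ∧ X.ConvergesTo (fun A => logMean (m A) f) g) :
    BddAbove (Set.range fun A => logVariation (m A)) := by
  have h' : ∀ f : ℝ → ℝ, X.Mem f →
      ∃ C : ℝ, ∀ A, X.xnorm (logMean (m A) f) ≤ ENNReal.ofReal C := fun f hf => by
    obtain ⟨g, hg, hfg⟩ := h f hf
    exact exists_xnorm_bound X (fun A => isBddMeas_logMean _ _) hg hfg
  obtain ⟨C, hC0, hC⟩ : ∃ C, 0 ≤ C ∧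
      ∀ A, absInt (fun t => logKernel (pairSeq 0 t) (m A)) ≤ C * harm (m A) := by
    cases X with
    | L1 => exact exists_kernel_bound_of_L1 hm2 h'
    | Cw => exact exists_kernel_bound_of_Cw hm2 h'
  refine ⟨2 * (12 + 4 * C), ?_⟩
  rintro _ ⟨A, rfl⟩
  exact logVariation_le 0 (hm2 A) hC0 (hC A)

end WalshLog

theorem theorem3 (X : WalshLog.Space) (m : ℕ → ℕ) (hm : StrictMono m) (hm2 : ∀ A, 2 ≤ m A) :
    (BddAbove (Set.range fun A => WalshLog.logVariation (m A)) ↔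
      ∀ f : ℝ → ℝ, X.Mem f → X.ConvergesTo (fun A => WalshLog.logMean (m A) f) f) ∧
    (BddAbove (Set.range fun A => WalshLog.logVariation (m A)) ↔
      ∀ f : ℝ → ℝ, X.Mem f →
        ∃ g : ℝ → ℝ, X.Mem g ∧ X.ConvergesTo (fun A => WalshLog.logMean (m A) f) g) :=
  ⟨⟨fun h _ hf => WalshLog.convergesTo_of_bddAbove X hm hm2 h hf,
    fun h => WalshLog.bddAbove_of_forall_convergesTo X hm2 fun f hf => ⟨f, hf, h f hf⟩⟩,
   ⟨fun h f hf => ⟨f, hf, WalshLog.convergesTo_of_bddAbove X hm hm2 h hf⟩,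
    fun h => WalshLog.bddAbove_of_forall_convergesTo X hm2 h⟩⟩
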